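/- Let $q,b,c,\lambda$ be complex numbers with $0<|q|<1$, $b\ne0$, $c\neq 0$ and $|\lambda q/b|<1$. Write $(a;q)_n=\prod_{j=0}^{n-1}(1-aq^j)$, $(a;q)_\infty=\prod_{j\ge0}(1-aq^j)$, $(a_1,\dots,a_r;q)_n=\prod_i (a_i;q)_n$ (also for $n=\infty$), $${}_2\phi_1\!\left[\begin{matrix}a_1,a_2\\ b_1\end{matrix};q,z\right]=\sum_{n\ge0}\frac{(a_1,a_2;q)_n}{(q,b_1;q)_n}z^n,$$ $$\int_{\alpha}^{\beta} f(t)\,d_qt=\beta(1-q)\sum_{n\ge0}q^nf(\beta q^n)-\alpha(1-q)\sum_{n\ge0}q^nf(\alpha q^n).$$ Let $x=\cos\vartheta$ with $\vartheta\in\mathbb C$, and assume that none of $e^{2i\vartheta}$, $2ce^{i\vartheta}$, $2ce^{-i\vartheta}$ is an integer power $q^m$, $m\in\mathbb Z$ (so that no denominator below vanishes). For integers $k\ge0$ define $$p_k(x)=\frac{4(-i\sin\vartheta)}{1-q}\,\frac{(2ce^{i\vartheta},2ce^{-i\vartheta};q)_\infty}{(q,e^{2i\vartheta},e^{-2i\vartheta};q)_\infty}\int_{\frac12e^{-i\vartheta}}^{\frac12e^{i\vartheta}}t^k\,\frac{(2qe^{i\vartheta}t,\,2qe^{-i\vartheta}t,\,-\lambda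 q/4bct;\,q)_\infty}{(4ct,\,q/4ct;\,q)_\infty}\,d_qt .$$ Then the $q$-integrals converge, $p_k(x)$ depends on $x$ but not on the choice of $\vartheta$ with $\cos\vartheta=x$, and for all $k\ge1$ $$x\,p_k(x)=p_{k+1}(x)+cq^kp_k(x)+\tfrac14\left(1+\lambda q^k/b\right)p_{k-1}(x).$$ Suppose further that $\lambda\ne0$ and $|\lambda q/2bc|<1$, and let $k\ge0$. (a) If $|e^{-i\vartheta}|\le1$, then the ${}_2\phi_1$ series below converges and $$p_k(x)=\frac{e^{ik\vartheta}\,(2ce^{-i\vartheta};q)_k\,\left(-\frac{\lambda q}{2bc}e^{-i\vartheta};q\right)_\infty}{2^k\left(\frac{q}{2c}e^{-i\vartheta};q\right)_\infty}\;{}_2\phi_1\!\left[\begin{matrix}-bq^{-k}/\lambda,\ 0\\ q^{1-k}e^{i\vartheta}/2c\end{matrix};q,\,-\frac{\lambda q}{2bc}e^{-i\vartheta}\right].$$ (b) If $|e^{i\vartheta}|\le1$, then the ${}_2\phi_1$ series below converges and $$p_k(x)=\frac{e^{-ik\vartheta}\,(2ce^{i\vartheta};q)_k\,\left(-\frac{\lambda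 q}{2bc}e^{i\vartheta};q\right)_\infty}{2^k\left(\frac{q}{2c}e^{i\vartheta};q\right)_\infty}\;{}_2\phi_1\!\left[\begin{matrix}-bq^{-k}/\lambda,\ 0\\ q^{1-k}e^{-i\vartheta}/2c\end{matrix};q,\,-\frac{\lambda q}{2bc}e^{i\vartheta}\right].$$ In particular, if $\vartheta$ is chosen with $0<\operatorname{Re}\vartheta<\pi$, then the formula in (a) holds when $\operatorname{Im}x\ge0$ and the formula in (b) holds when $\operatorname{Im}x\le0$. -/

import Mathlib

open scoped BigOperators

noncomputable section

/-- The `q`-rising factorial `(a; q)_n = (1 - a)(1 - a q) ⋯ (1 - a q^(n-1))`. -/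
def qRising (a q : ℂ) (n : ℕ) : ℂ := ∏ j ∈ Finset.range n, (1 - a * q ^ j)

/-- The infinite `q`-rising factorial `(a; q)_∞ = ∏_{j ≥ 0} (1 - a q^j)`, for `|q| < 1`. -/
def qRisingInf (a q : ℂ) : ℂ := ∏' j : ℕ, (1 - a * q ^ j)

/-- For `|q| < 1` the product defining `(a; q)_∞` converges, for every `a`. -/
theorem multipliable_qRisingInf (a : ℂ) {q : ℂ} (hq : ‖q‖ < 1) :
    Multipliable fun j : ℕ => 1 - a * q ^ j := by
  have h : Summable fun j : ℕ => ‖-(a * q ^ j)‖ := by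
    simp only [norm_neg, norm_mul, norm_pow]
    exact (summable_geometric_of_lt_one (norm_nonneg q) hq).mul_left _
  simpa [sub_eq_add_neg] using multipliable_one_add_of_summable h

/-- Convergence of the two series in the definition of the `q`-integral of `f` from `a` to `b`. -/
def QIntegrable (q : ℂ) (f : ℂ → ℂ) (a b : ℂ) : Prop :=
  (Summable fun n : ℕ => q ^ n * f (b * q ^ n)) ∧ Summable fun n : ℕ => q ^ n * f (a * q ^ n)

/-- The Jackson `q`-integral `∫_a^b f(t) d_q t`. -/
def qIntegral (q : ℂ) (f : ℂ → ℂ) (a b : ℂ) : ℂ :=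
  b * (1 - q) * ∑' n : ℕ, q ^ n * f (b * q ^ n) - a * (1 - q) * ∑' n : ℕ, q ^ n * f (a * q ^ n)

/-- The `n`-th term of the basic hypergeometric series `₂φ₁(a₁, a₂; b₁; q, z)`. -/
def phi21Term (a₁ a₂ b₁ q z : ℂ) (n : ℕ) : ℂ :=
  qRising a₁ q n * qRising a₂ q n / (qRising q q n * qRising b₁ q n) * z ^ n

/-- The basic hypergeometric series `₂φ₁(a₁, a₂; b₁; q, z)`. -/
def phi21 (a₁ a₂ b₁ q z : ℂ) : ℂ := ∑' n : ℕ, phi21Term a₁ a₂ b₁ q z n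

/-- `e^{iθ}`, for complex `θ`. -/
def expI (θ : ℂ) : ℂ := Complex.exp (Complex.I * θ)

/-- The integrand `t^k (2q e^{iθ} t, 2q e^{-iθ} t, -λq/(4bct); q)_∞ / (4ct, q/(4ct); q)_∞`. -/
def pIntegrand (q b c lam θ : ℂ) (k : ℕ) (t : ℂ) : ℂ :=
  t ^ k *
    (qRisingInf (2 * q * expI θ * t) q * qRisingInf (2 * q * expI (-θ) * t) q *
        qRisingInf (-(lam * q) / (4 * b * c * t)) q /
      (qRisingInf (4 * c * t) q * qRisingInf (q / (4 * c * t)) q))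

/-- The function `p_k(x)`, `x = cos θ`, given as a `q`-integral from `e^{-iθ}/2` to `e^{iθ}/2`. -/
def pFun (q b c lam θ : ℂ) (k : ℕ) : ℂ :=
  4 * (-Complex.I * Complex.sin θ) / (1 - q) *
    (qRisingInf (2 * c * expI θ) q * qRisingInf (2 * c * expI (-θ)) q /
      (qRisingInf q q * qRisingInf (expI (2 * θ)) q * qRisingInf (expI (-(2 * θ))) q)) *
    qIntegral q (pIntegrand q b c lam θ k) (expI (-θ) / 2) (expI θ / 2)

/-- The prefactor times `₂φ₁` series
`e^{ikθ} (2c e^{-iθ}; q)_k (-λq e^{-iθ}/(2bc); q)_∞ / (2^k (q e^{-iθ}/(2c); q)_∞)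
  · ₂φ₁(-b q^{-k}/λ, 0; q^{1-k} e^{iθ}/(2c); q, -λq e^{-iθ}/(2bc))`. -/
def pClosed (q b c lam θ : ℂ) (k : ℕ) : ℂ :=
  expI (k * θ) * qRising (2 * c * expI (-θ)) q k *
      qRisingInf (-(lam * q / (2 * b * c)) * expI (-θ)) q /
      (2 ^ k * qRisingInf (q / (2 * c) * expI (-θ)) q) *
    phi21 (-b * q ^ (-(k : ℤ)) / lam) 0 (q ^ (1 - (k : ℤ)) * expI θ / (2 * c)) q
      (-(lam * q / (2 * b * c)) * expI (-θ))

/-- The closed form `p_k(x) = pClosed`, together with the convergence of its `₂φ₁` series. The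
other determination of the angle is obtained by replacing `σ = θ` by `σ = -θ` on the right. -/
def HasClosedForm (q b c lam θ σ : ℂ) (k : ℕ) : Prop :=
  (Summable (phi21Term (-b * q ^ (-(k : ℤ)) / lam) 0 (q ^ (1 - (k : ℤ)) * expI σ / (2 * c)) q
      (-(lam * q / (2 * b * c)) * expI (-σ)))) ∧
    pFun q b c lam θ k = pClosed q b c lam σ k

end

open Filter Topology Finset

/-! Put w = e^{iθ}. On the lattice t = w q^n / 2 the denominator (4ct, q/4ct; q)_∞ is a theta
product, quasi-periodic in n, so the Jackson sum can be rid of it. Euler's expansion of (-λq/4bct;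
q)_∞ and an interchange of sums, absolutely convergent because |λq/b| < 1 (`summable_bilateral`),
turn this half of the q-integral into a series over j of ψ(q w², q y w), where ψ is `psiSeries` and
y = 2c q^{k-j}. The other half has w⁻¹ in place of w.

`connection_formula` merges the two halves, term by term in j, into the single function ψ(q/(yw),
qw/y), and the theta product of w² that it produces cancels against (e^{2iθ}, e^{-2iθ}; q)_∞ in the
normalisation (`pFun_mul_eq`). The series over j collapses by the finite q-binomial theorem
(`tsum_psiSeries_eq`), and a Heine-type transformation (`qRisingInf_mul_tsum_eq`) identifies the
result with the ₂φ₁. The transformation needs |λq e^{-iθ}/2bc| < 1, which explains the condition on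
|e^{-iθ}|; formula (b) is (a) for -θ, as p_k is even in θ.

The connection formula is a case of the cyclic relation `thetaProd_mul_psiSeries_cyclic`. There the
theta product in front of each ψ is written by the Jacobi triple product as a difference of partial
theta functions; each summand becomes a difference of two values of `kernelSeries`, and since that
kernel is symmetric the six values cancel in pairs.

The recurrence is independent of all this: the integrand satisfies a first-order q-difference
equation (`pIntegrand_zero_shift`), and 1 - 4xt + 4t² vanishes at both endpoints, so an index shift
leaves no boundary term. -/

/-! ### Finite and infinite q-rising factorials. -/

theorem qRising_zero (a q : ℂ) : qRising a q 0 = 1 := by simp [qRising]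

theorem qRising_succ (a q : ℂ) (n : ℕ) :
    qRising a q (n + 1) = qRising a q n * (1 - a * q ^ n) := by
  simp [qRising, prod_range_succ]

theorem qRising_succ' (a q : ℂ) (n : ℕ) :
    qRising a q (n + 1) = (1 - a) * qRising (a * q) q n := by
  simp only [qRising, prod_range_succ', pow_zero, mul_one]
  rw [mul_comm]
  congr 1
  exact prod_congr rfl fun i _ => by ring

theorem qRising_add (a q : ℂ) (m n : ℕ) :
    qRising a q (m + n) = qRising a q m * qRising (a * q ^ m) q n := by
  simp only [qRising, prod_range_add]
  congr 1
  exact prod_congr rfl fun i _ => by ring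

theorem qRising_zero_left (q : ℂ) (n : ℕ) : qRising 0 q n = 1 := by simp [qRising]

theorem qRising_ne_zero {a q : ℂ} (h : ∀ n : ℕ, a * q ^ n ≠ 1) (n : ℕ) : qRising a q n ≠ 0 :=
  prod_ne_zero_iff.2 fun i _ => sub_ne_zero.2 (h i).symm

theorem self_mul_pow_ne_one {q : ℂ} (hq : ‖q‖ < 1) (n : ℕ) : q * q ^ n ≠ 1 := by
  intro h
  have h1 : ‖q‖ ^ (n + 1) = 1 := by rw [← norm_pow, pow_succ', h, norm_one]
  exact (pow_lt_one₀ (norm_nonneg q) hq n.succ_ne_zero).ne h1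

theorem qRising_self_ne_zero {q : ℂ} (hq : ‖q‖ < 1) (n : ℕ) : qRising q q n ≠ 0 :=
  qRising_ne_zero (self_mul_pow_ne_one hq) n

theorem tendsto_qRising (a : ℂ) {q : ℂ} (hq : ‖q‖ < 1) :
    Tendsto (qRising a q) atTop (𝓝 (qRisingInf a q)) :=
  (multipliable_qRisingInf a hq).hasProd.tendsto_prod_nat

theorem qRisingInf_eq_mul (a : ℂ) {q : ℂ} (hq : ‖q‖ < 1) (n : ℕ) :
    qRisingInf a q = qRising a q n * qRisingInf (a * q ^ n) q := by
  have h1 := (tendsto_qRising a hq).comp (tendsto_add_atTop_nat n)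
  have h2 := (tendsto_qRising (a * q ^ n) hq).const_mul (qRising a q n)
  refine tendsto_nhds_unique h1 (h2.congr fun m => ?_)
  rw [Function.comp_apply, add_comm, qRising_add]

theorem qRisingInf_eq_one_sub_mul (a : ℂ) {q : ℂ} (hq : ‖q‖ < 1) :
    qRisingInf a q = (1 - a) * qRisingInf (a * q) q := by
  have := qRisingInf_eq_mul a hq 1
  rwa [qRising_succ, qRising_zero, pow_zero, one_mul, mul_one, pow_one] at this

theorem qRisingInf_ne_zero {a q : ℂ} (hq : ‖q‖ < 1) (h : ∀ n : ℕ, a * q ^ n ≠ 1) :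
    qRisingInf a q ≠ 0 := by
  have hs : Summable fun j : ℕ => ‖-(a * q ^ j)‖ := by
    simp only [norm_neg, norm_mul, norm_pow]
    exact (summable_geometric_of_lt_one (norm_nonneg q) hq).mul_left _
  have := tprod_one_add_ne_zero_of_summable (f := fun j : ℕ => -(a * q ^ j))
    (fun j => by
      rw [← sub_eq_add_neg]
      exact sub_ne_zero.2 (h j).symm) hs
  simpa [qRisingInf, sub_eq_add_neg] using this

theorem qRisingInf_self_ne_zero {q : ℂ} (hq : ‖q‖ < 1) : qRisingInf q q ≠ 0 :=
  qRisingInf_ne_zero hq (self_mul_pow_ne_one hq)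

/-- Partial products of a convergent infinite `q`-product are bounded. -/
theorem exists_norm_qRising_le (a : ℂ) {q : ℂ} (hq : ‖q‖ < 1) :
    ∃ C : ℝ, 0 < C ∧ ∀ n, ‖qRising a q n‖ ≤ C := by
  obtain ⟨C, hC⟩ := (Metric.isBounded_range_of_tendsto _ (tendsto_qRising a hq)).exists_norm_le
  exact ⟨max C 1, by positivity, fun n => (hC _ ⟨n, rfl⟩).trans (le_max_left _ _)⟩

theorem exists_norm_inv_qRising_le {a q : ℂ} (hq : ‖q‖ < 1) (h : ∀ n : ℕ, a * q ^ n ≠ 1) :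
    ∃ C : ℝ, 0 < C ∧ ∀ n, ‖(qRising a q n)⁻¹‖ ≤ C := by
  obtain ⟨C, hC⟩ := (Metric.isBounded_range_of_tendsto _
    ((tendsto_qRising a hq).inv₀ (qRisingInf_ne_zero hq h))).exists_norm_le
  exact ⟨max C 1, by positivity, fun n => (hC _ ⟨n, rfl⟩).trans (le_max_left _ _)⟩

/-! ### Powers with exponent n(n-1)/2 and their summability. -/

theorem pow_choose_two_succ {M : Type*} [CommMonoid M] (q : M) (n : ℕ) :
    q ^ (n + 1).choose 2 = q ^ n * q ^ n.choose 2 := by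
  rw [Nat.choose_succ_succ' n 1, Nat.choose_one_right, pow_add]

theorem pow_choose_two_add {M : Type*} [CommMonoid M] (q : M) (m n : ℕ) :
    q ^ (m + n).choose 2 = q ^ m.choose 2 * q ^ n.choose 2 * q ^ (m * n) := by
  induction n with
  | zero => simp
  | succ n ih =>
    rw [← add_assoc, pow_choose_two_succ, ih, pow_choose_two_succ, mul_add, mul_one, pow_add,
      pow_add]
    ac_rfl

theorem pow_choose_two_mul_succ {M : Type*} [CommMonoid M] (q : M) (n : ℕ) :
    q ^ n.choose 2 * q ^ (n + 1).choose 2 = q ^ (n * n) := by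
  induction n with
  | zero => simp
  | succ n ih =>
    rw [pow_choose_two_succ q (n + 1), show (n + 1) * (n + 1) = n * n + (n + (n + 1)) by ring,
      pow_add _ (n * n), ← ih, pow_add _ n (n + 1), pow_add _ n 1, pow_choose_two_succ, pow_succ, pow_zero, one_mul]
    ac_rfl

theorem summable_pow_mul_pow_choose {ρ : ℝ} (h0 : 0 ≤ ρ) (h1 : ρ < 1) (r : ℝ) :
    Summable fun n : ℕ => r ^ n * ρ ^ n.choose 2 := by
  have ht : Tendsto (fun n : ℕ => |r| * ρ ^ n) atTop (𝓝 0) := by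
    simpa using (tendsto_pow_atTop_nhds_zero_of_lt_one h0 h1).const_mul |r|
  refine summable_of_ratio_norm_eventually_le (r := 1 / 2) (by norm_num) ?_
  filter_upwards [ht.eventually (gt_mem_nhds (by norm_num : (0 : ℝ) < 1 / 2))] with n hn
  rw [pow_choose_two_succ, pow_succ]
  have : r ^ n * r * (ρ ^ n * ρ ^ n.choose 2) = (r * ρ ^ n) * (r ^ n * ρ ^ n.choose 2) := by ring
  rw [this, norm_mul]
  refine mul_le_mul_of_nonneg_right ?_ (norm_nonneg _)
  rw [norm_mul, norm_pow, Real.norm_eq_abs, Real.norm_eq_abs, abs_of_nonneg h0]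
  exact hn.le

theorem summable_norm_pow_mul_pow_choose {q : ℂ} (hq : ‖q‖ < 1) (z : ℂ) :
    Summable fun n : ℕ => ‖z ^ n * q ^ n.choose 2‖ := by
  simpa using summable_pow_mul_pow_choose (norm_nonneg q) hq ‖z‖

theorem summable_norm_mul_of_bounded {f g : ℕ → ℂ} (hf : Summable fun n => ‖f n‖)
    (hg : ∃ C : ℝ, 0 < C ∧ ∀ n, ‖g n‖ ≤ C) : Summable fun n => ‖f n * g n‖ := by
  obtain ⟨C, -, hC⟩ := hg
  refine Summable.of_nonneg_of_le (fun n => norm_nonneg _) (fun n => ?_) (hf.mul_right C)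
  rw [norm_mul]
  exact mul_le_mul_of_nonneg_left (hC n) (norm_nonneg _)

/-- A power series is continuous at `0` along the sequence `z q^m`. -/
theorem tendsto_tsum_mul_pow {q : ℂ} (hq : ‖q‖ < 1) (c : ℕ → ℂ) (z : ℂ)
    (h : Summable fun n => ‖c n * z ^ n‖) :
    Tendsto (fun m : ℕ => ∑' n, c n * (z * q ^ m) ^ n) atTop (𝓝 (c 0)) := by
  have key : Tendsto (fun m : ℕ => ∑' n, c n * (z * q ^ m) ^ n) atTop
      (𝓝 (∑' n, if n = 0 then c 0 else 0)) := by
    refine tendsto_tsum_of_dominated_convergence h (fun n => ?_) (Eventually.of_forall fun m n => ?_)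
    · rcases eq_or_ne n 0 with rfl | hn
      · simp
      · have h1 : Tendsto (fun m : ℕ => (z * q ^ m) ^ n) atTop (𝓝 ((z * 0) ^ n)) :=
          ((tendsto_pow_atTop_nhds_zero_of_norm_lt_one hq).const_mul z).pow n
        simpa [hn] using h1.const_mul (c n)
    · rw [mul_pow, ← mul_assoc, norm_mul]
      refine mul_le_of_le_one_right (norm_nonneg _) ?_
      rw [norm_pow, norm_pow]
      exact pow_le_one₀ (by positivity) (pow_le_one₀ (norm_nonneg _) hq.le)
  simpa using key

/-! ### Euler's expansion and the q-binomial theorems. -/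

theorem summable_norm_euler {q : ℂ} (hq : ‖q‖ < 1) (z : ℂ) :
    Summable fun n : ℕ => ‖z ^ n * q ^ n.choose 2 / qRising q q n‖ :=
  summable_norm_mul_of_bounded (summable_norm_pow_mul_pow_choose hq z)
    (exists_norm_inv_qRising_le hq (self_mul_pow_ne_one hq))

/-- If `F(z) (1 - b z) = (1 - a z) F(q z)` for a power series `F` with `F(0) = 1`, then
`F(z) (b z; q)_∞ = (a z; q)_∞`. -/
theorem tsum_mul_qRisingInf_of_functional {q : ℂ} (hq : ‖q‖ < 1) (c : ℕ → ℂ) (a b z : ℂ)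
    (h0 : c 0 = 1) (h : Summable fun n => ‖c n * z ^ n‖)
    (hrec : ∀ n, c (n + 1) * (1 - q ^ (n + 1)) = c n * (b - a * q ^ n)) :
    (∑' n, c n * z ^ n) * qRisingInf (b * z) q = qRisingInf (a * z) q := by
  have hs : ∀ m : ℕ, Summable fun n => c n * (z * q ^ m) ^ n := fun m => by
    refine Summable.of_norm_bounded h fun n => ?_
    rw [mul_pow, ← mul_assoc, norm_mul]
    refine mul_le_of_le_one_right (norm_nonneg _) ?_
    rw [norm_pow, norm_pow]
    exact pow_le_one₀ (by positivity) (pow_le_one₀ (norm_nonneg _) hq.le)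
  -- `hrec` is the functional equation read off at the coefficient of z^{n+1}.
  have step : ∀ m : ℕ, (∑' n, c n * (z * q ^ m) ^ n) * (1 - b * z * q ^ m) =
      (1 - a * z * q ^ m) * ∑' n, c n * (z * q ^ (m + 1)) ^ n := fun m => by
    have e1 := (hs m).tsum_eq_zero_add
    have e2 := (hs (m + 1)).tsum_eq_zero_add
    have s1 := (summable_nat_add_iff 1).2 (hs m)
    have s2 := (summable_nat_add_iff 1).2 (hs (m + 1))
    have e3 : ∑' n, c (n + 1) * (z * q ^ m) ^ (n + 1) -
        ∑' n, c (n + 1) * (z * q ^ (m + 1)) ^ (n + 1) =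
        b * z * q ^ m * ∑' n, c n * (z * q ^ m) ^ n -
        a * z * q ^ m * ∑' n, c n * (z * q ^ (m + 1)) ^ n := by
      rw [← s1.tsum_sub s2, ← tsum_mul_left, ← tsum_mul_left,
        ← ((hs m).mul_left _).tsum_sub ((hs (m + 1)).mul_left _)]
      refine tsum_congr fun n => ?_
      have := hrec n
      calc _ = c (n + 1) * (1 - q ^ (n + 1)) * (z * q ^ m) ^ (n + 1) := by
            rw [show z * q ^ (m + 1) = z * q ^ m * q by ring, mul_pow _ q]; ring
        _ = _ := by
            rw [this, show z * q ^ (m + 1) = z * q ^ m * q by ring, mul_pow _ q]; ring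
    simp only [pow_zero, mul_one] at e1 e2
    linear_combination (1 : ℂ) * e1 - e2 + e3
  -- Iterating m times moves the argument to z q^m; as m → ∞ the series tends to its constant term
  -- 1.
  have iter : ∀ m : ℕ, (∑' n, c n * z ^ n) * qRising (b * z) q m =
      qRising (a * z) q m * ∑' n, c n * (z * q ^ m) ^ n := fun m => by
    induction m with
    | zero => simp [qRising_zero]
    | succ m ih =>
      rw [qRising_succ, qRising_succ, ← mul_assoc, ih, mul_assoc, step]
      ring
  refine tendsto_nhds_unique ((tendsto_qRising (b * z) hq).const_mul _) ?_
  have := (tendsto_qRising (a * z) hq).mul (tendsto_tsum_mul_pow hq c z h)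
  rw [h0, mul_one] at this
  exact this.congr fun m => (iter m).symm

/-- Euler's expansion of `(z; q)_∞`. -/
theorem qRisingInf_eq_tsum {q : ℂ} (hq : ‖q‖ < 1) (z : ℂ) :
    qRisingInf z q = ∑' n : ℕ, (-z) ^ n * q ^ n.choose 2 / qRising q q n := by
  have h := tsum_mul_qRisingInf_of_functional hq
    (fun n => (-1) ^ n * q ^ n.choose 2 / qRising q q n) 1 0 z (by simp [qRising_zero])
    ((summable_norm_euler hq (-z)).congr fun n => by
      congr 1; rw [neg_pow z]; ring)
    (fun n => by
      have h1 := qRising_self_ne_zero hq n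
      have h2 := qRising_self_ne_zero hq (n + 1)
      have h3 : 1 - q ^ (n + 1) ≠ 0 := by
        rw [qRising_succ] at h2
        simpa [pow_succ'] using right_ne_zero_of_mul h2
      rw [pow_choose_two_succ, qRising_succ, show 1 - q * q ^ n = 1 - q ^ (n + 1) by ring]
      field_simp
      ring)
  rw [zero_mul, one_mul] at h
  rw [← h, show qRisingInf 0 q = 1 by simp [qRisingInf], mul_one]
  refine tsum_congr fun n => ?_
  rw [neg_pow z]; ring

theorem summable_norm_qBinomial (a : ℂ) {q z : ℂ} (hq : ‖q‖ < 1) (hz : ‖z‖ < 1) :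
    Summable fun n : ℕ => ‖qRising a q n / qRising q q n * z ^ n‖ := by
  have h1 : Summable fun n : ℕ => ‖z ^ n‖ := by
    simpa using summable_geometric_of_lt_one (norm_nonneg z) hz
  refine (summable_norm_mul_of_bounded (summable_norm_mul_of_bounded h1
    (exists_norm_qRising_le a hq)) (exists_norm_inv_qRising_le hq (self_mul_pow_ne_one hq))).congr
    fun n => ?_
  congr 1; ring

/-- The `q`-binomial theorem. -/
theorem tsum_qBinomial (a : ℂ) {q z : ℂ} (hq : ‖q‖ < 1) (hz : ‖z‖ < 1) :
    (∑' n : ℕ, qRising a q n / qRising q q n * z ^ n) * qRisingInf z q = qRisingInf (a * z) q := by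
  have h := tsum_mul_qRisingInf_of_functional hq
    (fun n => qRising a q n / qRising q q n) a 1 z (by simp [qRising_zero])
    (summable_norm_qBinomial a hq hz)
    (fun n => by
      have h1 := qRising_self_ne_zero hq n
      have h2 := qRising_self_ne_zero hq (n + 1)
      have h3 : 1 - q ^ (n + 1) ≠ 0 := by
        rw [qRising_succ] at h2
        simpa [pow_succ'] using right_ne_zero_of_mul h2
      rw [qRising_succ, qRising_succ, show 1 - q * q ^ n = 1 - q ^ (n + 1) by ring]
      field_simp)
  rwa [one_mul] at h

theorem one_sub_pow_succ_div_qRising {q : ℂ} (hq : ‖q‖ < 1) (n : ℕ) :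
    (1 - q ^ (n + 1)) / qRising q q (n + 1) = 1 / qRising q q n := by
  have h1 := qRising_self_ne_zero hq n
  have h2 := qRising_self_ne_zero hq (n + 1)
  have h3 : 1 - q ^ (n + 1) ≠ 0 := by
    rw [qRising_succ] at h2
    simpa [pow_succ'] using right_ne_zero_of_mul h2
  rw [qRising_succ, show 1 - q * q ^ n = 1 - q ^ (n + 1) by ring]
  field_simp

/-- The finite `q`-binomial theorem. -/
theorem sum_antidiagonal_rothe {q : ℂ} (hq : ‖q‖ < 1) (a : ℂ) (M : ℕ) :
    ∑ p ∈ antidiagonal M, (-a) ^ p.1 * q ^ p.1.choose 2 / qRising q q p.1 * (1 / qRising q q p.2) =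
      qRising a q M / qRising q q M := by
  induction M with
  | zero => simp [qRising_zero]
  | succ M ih =>
    have h2 := qRising_self_ne_zero hq (M + 1)
    have h3 : 1 - q ^ (M + 1) ≠ 0 := by
      rw [qRising_succ] at h2
      simpa [pow_succ'] using right_ne_zero_of_mul h2
    have h4 : qRising a q (M + 1) / qRising q q (M + 1) =
        (1 - q ^ (M + 1))⁻¹ * ((1 - a * q ^ M) * (qRising a q M / qRising q q M)) := by
      have h1 := qRising_self_ne_zero hq M
      rw [qRising_succ, qRising_succ, show 1 - q * q ^ M = 1 - q ^ (M + 1) by ring]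
      field_simp
    rw [h4, eq_inv_mul_iff_mul_eq₀ h3, ← ih, mul_sum]
    -- With p.1 + p.2 = M + 1, 1 - q^{M+1} = (1 - q^{p.2}) + q^{p.2} (1 - q^{p.1}); each piece
    -- cancels the last factor of one denominator and so drops to level M.
    have split : ∀ p ∈ antidiagonal (M + 1), (1 - q ^ (M + 1)) *
        ((-a) ^ p.1 * q ^ p.1.choose 2 / qRising q q p.1 * (1 / qRising q q p.2)) =
        (-a) ^ p.1 * q ^ p.1.choose 2 / qRising q q p.1 * ((1 - q ^ p.2) / qRising q q p.2) +
        (-a) ^ p.1 * q ^ p.1.choose 2 * ((1 - q ^ p.1) / qRising q q p.1) *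
          (q ^ p.2 / qRising q q p.2) := by
      intro p hp
      rw [← mem_antidiagonal.1 hp, pow_add]
      ring
    rw [sum_congr rfl split, sum_add_distrib, Nat.sum_antidiagonal_succ', Nat.sum_antidiagonal_succ]
    simp only [pow_zero, sub_self, zero_div, mul_zero, zero_mul, zero_add,
      one_sub_pow_succ_div_qRising hq]
    rw [← sum_add_distrib, mul_sum]
    refine sum_congr rfl fun p hp => ?_
    rw [pow_choose_two_succ, ← mem_antidiagonal.1 hp, pow_add]
    ring

/-! ### The Jacobi triple product. -/

/-- The partial theta function `∑_{k ≥ 0} (-x)^k q^{k(k+1)/2}`. -/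
noncomputable def partialTheta (q x : ℂ) : ℂ := ∑' k : ℕ, (-x) ^ k * q ^ (k + 1).choose 2

/-- The product `(x, q/x; q)_∞`. -/
noncomputable def thetaProd (q x : ℂ) : ℂ := qRisingInf x q * qRisingInf (q / x) q

/-- The product read backwards: 1 - a q^j = -a q^j (1 - (q/x) q^{n-1-j}). -/
theorem qRising_reflect {q x a : ℂ} (hq : q ≠ 0) (ha : a ≠ 0) (n : ℕ) (h : a * q ^ n = x) :
    qRising a q n = (-a) ^ n * q ^ n.choose 2 * qRising (q / x) q n := by
  induction n generalizing a with
  | zero => simp [qRising_zero]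
  | succ n ih =>
    rw [qRising_succ', ih (mul_ne_zero ha hq) (by rw [← h]; ring), qRising_succ,
      pow_choose_two_succ, ← h]
    field_simp
    ring

/-- A finite triple product: the finite q-binomial theorem of degree 2n at a = x q^{-n}, where (a;
q)_{2n} = (a; q)_n (x; q)_n and the first factor is reversed. The sum is cut at its middle index n,
giving the powers of x and of 1/x. -/
theorem qRising_mul_qRising_eq_sum {q x : ℂ} (hq0 : q ≠ 0) (hq : ‖q‖ < 1) (hx : x ≠ 0) (n : ℕ) :
    qRising x q n * qRising (q / x) q n =
      ∑ k ∈ range (n + 1), (-x) ^ k * q ^ k.choose 2 *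
          (qRising q q (2 * n) / (qRising q q (n + k) * qRising q q (n - k))) +
        ∑ k ∈ range n, (-(1 / x)) ^ (k + 1) * q ^ (k + 2).choose 2 *
          (qRising q q (2 * n) / (qRising q q (n + (k + 1)) * qRising q q (n - (k + 1)))) := by
  obtain ⟨a, ha⟩ : ∃ a, a * q ^ n = x := ⟨x / q ^ n, by field_simp⟩
  have ha0 : a ≠ 0 := by rintro rfl; exact hx (by rw [← ha, zero_mul])
  have hA : (-a) ^ n * q ^ n.choose 2 ≠ 0 :=
    mul_ne_zero (pow_ne_zero _ (neg_ne_zero.2 ha0)) (pow_ne_zero _ hq0)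
  have h1 : qRising a q (2 * n) =
      (-a) ^ n * q ^ n.choose 2 * (qRising x q n * qRising (q / x) q n) := by
    rw [two_mul, qRising_add, ha, qRising_reflect hq0 ha0 n ha]
    ring
  refine mul_left_cancel₀ hA ?_
  rw [← h1]
  have h2 := sum_antidiagonal_rothe hq a (2 * n)
  rw [eq_div_iff (qRising_self_ne_zero hq _)] at h2
  rw [← h2, Nat.sum_antidiagonal_eq_sum_range_succ
    (fun i j => (-a) ^ i * q ^ i.choose 2 / qRising q q i * (1 / qRising q q j)),
    show (2 * n).succ = n + (n + 1) by omega, sum_range_add, add_mul, add_comm, mul_add]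
  congr 1
  · rw [sum_mul, mul_sum]
    refine sum_congr rfl fun k hk => ?_
    rw [show 2 * n - (n + k) = n - k by omega, pow_choose_two_add, ← ha]
    rw [show (-(a * q ^ n)) ^ k = (-a) ^ k * q ^ (n * k) by rw [pow_mul, ← mul_pow]; ring, pow_add]
    ring
  · rw [← sum_range_reflect, sum_mul, mul_sum]
    refine sum_congr rfl fun k hk => ?_
    have hk' : k < n := mem_range.1 hk
    obtain ⟨j, rfl⟩ : ∃ j, n = j + (k + 1) := ⟨n - (k + 1), by omega⟩
    rw [show j + (k + 1) - 1 - k = j by omega, show j + (k + 1) - (k + 1) = j by omega,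
      show 2 * (j + (k + 1)) - j = j + (k + 1) + (k + 1) by omega]
    have e : (-a) ^ (j + (k + 1)) * q ^ (j + (k + 1)).choose 2 *
        ((-(1 / x)) ^ (k + 1) * q ^ (k + 2).choose 2) = (-a) ^ j * q ^ j.choose 2 := by
      have e1 : (-(1 / x)) ^ (k + 1) * ((-a) ^ (k + 1) * q ^ ((j + (k + 1)) * (k + 1))) = 1 := by
        rw [pow_mul, ← mul_pow, ← mul_pow, ← ha]
        convert one_pow (k + 1) using 2
        field_simp
      have e2 := pow_choose_two_mul_succ q (k + 1)
      rw [add_mul j, pow_add q, ← e2] at e1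
      rw [pow_choose_two_add, pow_add]
      linear_combination ((-a) ^ j * q ^ j.choose 2) * e1
    linear_combination (-(qRising q q (2 * (j + (k + 1))) /
      (qRising q q (j + (k + 1) + (k + 1)) * qRising q q j))) * e

theorem summable_norm_partialTheta {q : ℂ} (hq : ‖q‖ < 1) (x : ℂ) :
    Summable fun k : ℕ => ‖x ^ k * q ^ (k + 1).choose 2‖ :=
  (summable_norm_pow_mul_pow_choose hq (x * q)).congr fun k => by
    rw [pow_choose_two_succ, mul_pow]; congr 1; ring

/-- The `q`-binomial coefficient `[2n; n+k]`, extended by zero. -/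
noncomputable def centralQBinom (q : ℂ) (n k : ℕ) : ℂ :=
  if k ≤ n then qRising q q (2 * n) / (qRising q q (n + k) * qRising q q (n - k)) else 0

theorem exists_norm_centralQBinom_le {q : ℂ} (hq : ‖q‖ < 1) :
    ∃ C : ℝ, 0 < C ∧ ∀ n k, ‖centralQBinom q n k‖ ≤ C := by
  obtain ⟨A, hA0, hA⟩ := exists_norm_qRising_le q hq
  obtain ⟨B, hB0, hB⟩ := exists_norm_inv_qRising_le hq (self_mul_pow_ne_one hq)
  refine ⟨A * (B * B), by positivity, fun n k => ?_⟩
  rw [centralQBinom]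
  split_ifs
  · rw [div_eq_mul_inv, mul_inv, norm_mul, norm_mul]
    gcongr
    exacts [hA _, hB _, hB _]
  · rw [norm_zero]; positivity

theorem tendsto_centralQBinom {q : ℂ} (hq : ‖q‖ < 1) (k : ℕ) :
    Tendsto (fun n => centralQBinom q n k) atTop (𝓝 (qRisingInf q q)⁻¹) := by
  have h0 := qRisingInf_self_ne_zero hq
  have h := tendsto_qRising q hq
  have h1 := h.comp (tendsto_id.const_mul_atTop' (by norm_num : 0 < 2))
  have h2 := h.comp (tendsto_add_atTop_nat k)
  have h3 := h.comp (tendsto_sub_atTop_nat k)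
  have h4 := h1.div (h2.mul h3) (mul_ne_zero h0 h0)
  rw [show (qRisingInf q q)⁻¹ = qRisingInf q q / (qRisingInf q q * qRisingInf q q) by field_simp]
  refine h4.congr' ?_
  filter_upwards [eventually_ge_atTop k] with n hn
  simp [centralQBinom, hn]

/-- Dominated convergence for the limit n → ∞ of the finite triple product; the offset r is 0 for
the powers of x and 1 for those of 1/x. -/
theorem tendsto_tsum_mul_centralQBinom {q : ℂ} (hq : ‖q‖ < 1) (f : ℕ → ℂ)
    (hf : Summable fun k => ‖f k‖) (r : ℕ) :
    Tendsto (fun n => ∑' k, f k * centralQBinom q n (k + r)) atTop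
      (𝓝 ((∑' k, f k) * (qRisingInf q q)⁻¹)) := by
  obtain ⟨C, hC0, hC⟩ := exists_norm_centralQBinom_le hq
  rw [← tsum_mul_right]
  refine tendsto_tsum_of_dominated_convergence (hf.mul_right C)
    (fun k => (tendsto_centralQBinom hq _).const_mul _) (Eventually.of_forall fun n k => ?_)
  rw [norm_mul]
  exact mul_le_mul_of_nonneg_left (hC _ _) (norm_nonneg _)

/-- The Jacobi triple product identity. -/
theorem qRisingInf_mul_thetaProd {q x : ℂ} (hq0 : q ≠ 0) (hq : ‖q‖ < 1) (hx : x ≠ 0) :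
    qRisingInf q q * thetaProd q x = partialTheta q (1 / x) - x * partialTheta q x := by
  have s1 : Summable fun k : ℕ => ‖(-x) ^ k * q ^ k.choose 2‖ :=
    summable_norm_pow_mul_pow_choose hq _
  have s2 : Summable fun k : ℕ => ‖(-(1 / x)) ^ (k + 1) * q ^ (k + 2).choose 2‖ :=
    (summable_nat_add_iff 1).2 (summable_norm_partialTheta hq (-(1 / x)))
  have lim := (tendsto_tsum_mul_centralQBinom hq _ s1 0).add
    (tendsto_tsum_mul_centralQBinom hq _ s2 1)
  have lim2 := (tendsto_qRising x hq).mul (tendsto_qRising (q / x) hq)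
  have e := tendsto_nhds_unique lim2 (lim.congr fun n => by
    rw [qRising_mul_qRising_eq_sum hq0 hq hx]
    congr 1
    · rw [tsum_eq_sum (s := range (n + 1)) fun k hk => by
        rw [centralQBinom, if_neg (by simpa using hk), mul_zero]]
      refine sum_congr rfl fun k hk => ?_
      rw [centralQBinom, if_pos (by simpa [Nat.lt_succ_iff] using hk), add_zero]
    · rw [tsum_eq_sum (s := range n) fun k hk => by
        rw [centralQBinom, if_neg (by simpa [Nat.lt_succ_iff] using hk), mul_zero]]
      refine sum_congr rfl fun k hk => ?_
      rw [centralQBinom, if_pos (by simpa [Nat.succ_le_iff] using hk)])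
  have e1 : ∑' k : ℕ, (-x) ^ k * q ^ k.choose 2 = 1 - x * partialTheta q x := by
    rw [s1.of_norm.tsum_eq_zero_add, partialTheta, ← tsum_mul_left, sub_eq_add_neg, ← tsum_neg]
    congr 1
    · simp
    · exact tsum_congr fun k => by ring
  have e2 : partialTheta q (1 / x) =
      1 + ∑' k : ℕ, (-(1 / x)) ^ (k + 1) * q ^ (k + 2).choose 2 := by
    rw [partialTheta, (summable_norm_partialTheta hq _).of_norm.tsum_eq_zero_add]
    simp
  rw [thetaProd, e, e1, e2]
  have h0 := qRisingInf_self_ne_zero hq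
  field_simp
  ring

/-! ### The function ψ and the Rogers–Szegő polynomials. -/

theorem summable_prod_of_norm_le {f g : ℕ → ℂ} {F : ℕ × ℕ → ℂ} {C : ℝ}
    (hf : Summable fun n => ‖f n‖) (hg : Summable fun n => ‖g n‖)
    (h : ∀ m n, ‖F (m, n)‖ ≤ C * (‖f m‖ * ‖g n‖)) : Summable F :=
  Summable.of_norm_bounded
    ((hf.mul_of_nonneg hg (fun _ => norm_nonneg _) fun _ => norm_nonneg _).mul_left C)
    fun p => h p.1 p.2

theorem tsum_tsum_eq_tsum_sum_antidiagonal {F : ℕ × ℕ → ℂ} (hF : Summable F) :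
    ∑' m, ∑' n, F (m, n) = ∑' N, ∑ p ∈ antidiagonal N, F p := by
  have h := (HasAntidiagonal.sigmaAntidiagonalEquivProd (A := ℕ)).summable_iff.2 hF
  rw [← hF.tsum_prod, ← HasAntidiagonal.sigmaAntidiagonalEquivProd.tsum_eq F]
  refine (h.tsum_sigma' fun N => (hasSum_fintype _).summable).trans ?_
  refine tsum_congr fun N => ?_
  rw [tsum_fintype]
  exact sum_finset_coe (fun p => F p) _

/-- The series `∑_m (-β)^m q^{m(m-1)/2} (α q^m; q)_∞ / (q; q)_m`. -/
noncomputable def psiSeries (q α β : ℂ) : ℂ :=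
  ∑' m : ℕ, (-β) ^ m * q ^ m.choose 2 / qRising q q m * qRisingInf (α * q ^ m) q

/-- The homogeneous Rogers–Szegő polynomial, divided by `(q; q)_N`. -/
noncomputable def rogersSzego (q u v : ℂ) (N : ℕ) : ℂ :=
  ∑ p ∈ antidiagonal N, u ^ p.1 / qRising q q p.1 * (v ^ p.2 / qRising q q p.2)

/-- The double series of which `psiSeries` is an iterated sum. -/
noncomputable def psiTerm (q α β : ℂ) (p : ℕ × ℕ) : ℂ :=
  (-β) ^ p.1 / qRising q q p.1 * ((-α) ^ p.2 / qRising q q p.2) * q ^ (p.1 + p.2).choose 2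

theorem summable_psiTerm {q : ℂ} (hq : ‖q‖ < 1) (α β : ℂ) : Summable (psiTerm q α β) := by
  refine summable_prod_of_norm_le (C := 1) (summable_norm_euler hq (-β)) (summable_norm_euler hq (-α))
    fun m n => ?_
  rw [one_mul, ← norm_mul, psiTerm, pow_choose_two_add]
  have : (-β) ^ m / qRising q q m * ((-α) ^ n / qRising q q n) *
      (q ^ m.choose 2 * q ^ n.choose 2 * q ^ (m * n)) =
      ((-β) ^ m * q ^ m.choose 2 / qRising q q m * ((-α) ^ n * q ^ n.choose 2 / qRising q q n)) *
        q ^ (m * n) := by ring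
  rw [this, norm_mul _ (q ^ (m * n)), norm_pow]
  exact mul_le_of_le_one_right (norm_nonneg _) (pow_le_one₀ (norm_nonneg _) hq.le)

theorem psiSeries_eq_tsum_tsum {q : ℂ} (hq : ‖q‖ < 1) (α β : ℂ) :
    psiSeries q α β = ∑' m, ∑' n, psiTerm q α β (m, n) := by
  refine tsum_congr fun m => ?_
  rw [qRisingInf_eq_tsum hq, ← tsum_mul_left]
  refine tsum_congr fun n => ?_
  rw [psiTerm, pow_choose_two_add, show -(α * q ^ m) = -α * q ^ m by ring, mul_pow (-α), ← pow_mul]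
  ring

/-- Euler's expansion merges the powers of q into q^{(m+n)(m+n-1)/2}, which makes the double series
symmetric. -/
theorem psiSeries_comm {q : ℂ} (hq : ‖q‖ < 1) (α β : ℂ) : psiSeries q α β = psiSeries q β α := by
  rw [psiSeries_eq_tsum_tsum hq, psiSeries_eq_tsum_tsum hq, ← Summable.tsum_comm (f := fun m n => psiTerm q α β (m, n)) (summable_psiTerm hq α β)]
  refine tsum_congr fun m => tsum_congr fun n => ?_
  simp only [psiTerm]
  rw [add_comm n m]
  ring

theorem psiSeries_eq_tsum {q : ℂ} (hq : ‖q‖ < 1) (α β : ℂ) :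
    psiSeries q α β = ∑' N : ℕ, (-1) ^ N * q ^ N.choose 2 * rogersSzego q α β N := by
  rw [psiSeries_comm hq, psiSeries_eq_tsum_tsum hq,
    tsum_tsum_eq_tsum_sum_antidiagonal (summable_psiTerm hq β α)]
  refine tsum_congr fun N => ?_
  rw [rogersSzego, mul_sum]
  refine sum_congr rfl fun p hp => ?_
  rw [psiTerm, ← mem_antidiagonal.1 hp, neg_pow α, neg_pow β, pow_add]
  ring

theorem rogersSzego_zero (q u v : ℂ) : rogersSzego q u v 0 = 1 := by
  simp [rogersSzego, qRising_zero]

theorem rogersSzego_mul (q r u v : ℂ) (N : ℕ) :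
    rogersSzego q (r * u) (r * v) N = r ^ N * rogersSzego q u v N := by
  rw [rogersSzego, rogersSzego, mul_sum]
  refine sum_congr rfl fun p hp => ?_
  rw [← mem_antidiagonal.1 hp, mul_pow, mul_pow, pow_add]
  ring

theorem rogersSzego_one {q : ℂ} (hq : ‖q‖ < 1) (u v : ℂ) :
    (1 - q) * rogersSzego q u v 1 = u + v := by
  have h := one_sub_pow_succ_div_qRising hq 0
  simp only [zero_add, pow_one, qRising_zero, div_one] at h
  rw [rogersSzego, Nat.sum_antidiagonal_succ]
  simp only [Nat.antidiagonal_zero, sum_singleton, zero_add, pow_zero, pow_one, qRising_zero]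
  linear_combination (u + v) * h

theorem rogersSzego_succ_succ {q : ℂ} (hq : ‖q‖ < 1) (u v : ℂ) (N : ℕ) :
    (1 - q ^ (N + 2)) * rogersSzego q u v (N + 2) =
      (u + v) * rogersSzego q u v (N + 1) - u * v * rogersSzego q u v N := by
  -- Uses 1 - ab = (1 - a) + (1 - b) - (1 - a)(1 - b) with a = q^{p.1}, b = q^{p.2}; each factor
  -- lowers one index.
  have split : (1 - q ^ (N + 2)) * rogersSzego q u v (N + 2) =
      ∑ p ∈ antidiagonal (N + 2), u ^ p.1 * ((1 - q ^ p.1) / qRising q q p.1) *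
        (v ^ p.2 / qRising q q p.2) +
      ∑ p ∈ antidiagonal (N + 2), u ^ p.1 / qRising q q p.1 *
        (v ^ p.2 * ((1 - q ^ p.2) / qRising q q p.2)) -
      ∑ p ∈ antidiagonal (N + 2), u ^ p.1 * ((1 - q ^ p.1) / qRising q q p.1) *
        (v ^ p.2 * ((1 - q ^ p.2) / qRising q q p.2)) := by
    rw [rogersSzego, mul_sum, ← sum_add_distrib, ← sum_sub_distrib]
    refine sum_congr rfl fun p hp => ?_
    rw [← mem_antidiagonal.1 hp, pow_add]
    ring
  rw [split]
  congr 1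
  · rw [add_mul]
    congr 1
    · rw [Nat.sum_antidiagonal_succ, rogersSzego, mul_sum]
      simp only [pow_zero, sub_self, zero_div, mul_zero, zero_mul, zero_add,
        one_sub_pow_succ_div_qRising hq]
      exact sum_congr rfl fun p _ => by ring
    · rw [Nat.sum_antidiagonal_succ', rogersSzego, mul_sum]
      simp only [pow_zero, sub_self, zero_div, mul_zero, zero_add,
        one_sub_pow_succ_div_qRising hq]
      exact sum_congr rfl fun p _ => by ring
  · rw [Nat.sum_antidiagonal_succ, Nat.sum_antidiagonal_succ', rogersSzego, mul_sum]
    simp only [pow_zero, sub_self, zero_div, mul_zero, zero_mul, zero_add,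
      one_sub_pow_succ_div_qRising hq]
    exact sum_congr rfl fun p _ => by ring

/-! ### The symmetric kernel and the connection formula. -/

/-- The quotient `(q; q)_{N+A} / (q; q)_A`. -/
noncomputable def qRisingRatio (q : ℂ) (N A : ℕ) : ℂ := qRising q q (N + A) / qRising q q A

theorem exists_norm_qRisingRatio_le {q : ℂ} (hq : ‖q‖ < 1) :
    ∃ C : ℝ, 0 < C ∧ ∀ N A, ‖qRisingRatio q N A‖ ≤ C := by
  obtain ⟨A, hA0, hA⟩ := exists_norm_qRising_le q hq
  obtain ⟨B, hB0, hB⟩ := exists_norm_inv_qRising_le hq (self_mul_pow_ne_one hq)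
  refine ⟨A * B, by positivity, fun n k => ?_⟩
  rw [qRisingRatio, div_eq_mul_inv, norm_mul]
  gcongr
  exacts [hA _, hB _]

/-- The series `∑_A (-x)^A q^{A(A+1)/2} (q; q)_{N+A} / (q; q)_A`. -/
noncomputable def kappaSeries (q x : ℂ) (N : ℕ) : ℂ :=
  ∑' A : ℕ, (-x) ^ A * q ^ (A + 1).choose 2 * qRisingRatio q N A

theorem summable_norm_kappaSeries {q : ℂ} (hq : ‖q‖ < 1) (x : ℂ) (N : ℕ) :
    Summable fun A : ℕ => ‖(-x) ^ A * q ^ (A + 1).choose 2 * qRisingRatio q N A‖ := by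
  obtain ⟨C, h0, hC⟩ := exists_norm_qRisingRatio_le hq
  exact summable_norm_mul_of_bounded (summable_norm_partialTheta hq _) ⟨C, h0, hC N⟩

theorem kappaSeries_zero {q : ℂ} (hq : ‖q‖ < 1) (x : ℂ) :
    kappaSeries q x 0 = partialTheta q x := by
  refine tsum_congr fun A => ?_
  rw [qRisingRatio, zero_add, div_self (qRising_self_ne_zero hq A), mul_one]

theorem mul_kappaSeries_sub {q : ℂ} (hq : ‖q‖ < 1) (x : ℂ) (N : ℕ) :
    x * (kappaSeries q x N - kappaSeries q x (N + 1)) =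
      -∑' A : ℕ, (-x) ^ (A + 1) * q ^ (A + 2).choose 2 * q ^ N * qRisingRatio q N A := by
  rw [kappaSeries, kappaSeries, ← (summable_norm_kappaSeries hq x N).of_norm.tsum_sub
    (summable_norm_kappaSeries hq x (N + 1)).of_norm, ← tsum_mul_left, ← tsum_neg]
  refine tsum_congr fun A => ?_
  rw [qRisingRatio, qRisingRatio, show N + 1 + A = N + A + 1 by ring, qRising_succ,
    pow_choose_two_succ q (A + 1)]
  ring

theorem kappaSeries_one {q : ℂ} (hq : ‖q‖ < 1) (x : ℂ) :
    x * kappaSeries q x 1 = (1 + x) * kappaSeries q x 0 - 1 := by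
  have h := mul_kappaSeries_sub hq x 0
  have e : kappaSeries q x 0 = 1 + ∑' A : ℕ, (-x) ^ (A + 1) * q ^ (A + 2).choose 2 * q ^ 0 *
      qRisingRatio q 0 A := by
    rw [kappaSeries, (summable_norm_kappaSeries hq x 0).of_norm.tsum_eq_zero_add]
    congr 1
    · simp [qRisingRatio, qRising_zero]
    · refine tsum_congr fun A => ?_
      simp [qRisingRatio, div_self (qRising_self_ne_zero hq _)]
  linear_combination -h - e

theorem kappaSeries_succ_succ {q : ℂ} (hq : ‖q‖ < 1) (x : ℂ) (M : ℕ) :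
    x * kappaSeries q x (M + 2) =
      (1 + x) * kappaSeries q x (M + 1) - (1 - q ^ (M + 1)) * kappaSeries q x M := by
  have h := mul_kappaSeries_sub hq x (M + 1)
  have s1 := (summable_norm_kappaSeries hq x (M + 1)).of_norm
  have s2 := (summable_norm_kappaSeries hq x M).of_norm.mul_left (1 - q ^ (M + 1))
  -- The terms A = 0 cancel. At A + 1, (1 - q^{M+A+2}) - (1 - q^{M+1}) = q^{M+1} (1 - q^{A+1}),
  -- which reproduces the series of `mul_kappaSeries_sub` at N = M + 1.
  have e : kappaSeries q x (M + 1) - (1 - q ^ (M + 1)) * kappaSeries q x M =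
      ∑' A : ℕ, (-x) ^ (A + 1) * q ^ (A + 2).choose 2 * q ^ (M + 1) *
        qRisingRatio q (M + 1) A := by
    rw [kappaSeries, kappaSeries, ← tsum_mul_left, ← s1.tsum_sub s2, (s1.sub s2).tsum_eq_zero_add]
    have z : (-x) ^ 0 * q ^ (0 + 1).choose 2 * qRisingRatio q (M + 1) 0 -
        (1 - q ^ (M + 1)) * ((-x) ^ 0 * q ^ (0 + 1).choose 2 * qRisingRatio q M 0) = 0 := by
      simp only [qRisingRatio, add_zero, qRising_succ]
      ring
    rw [z, zero_add]
    refine tsum_congr fun A => ?_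
    have hA := one_sub_pow_succ_div_qRising hq A
    rw [qRisingRatio, qRisingRatio, qRisingRatio, show M + 1 + (A + 1) = M + 1 + A + 1 by ring,
      show M + (A + 1) = M + 1 + A by ring, qRising_succ _ _ (M + 1 + A)]
    linear_combination ((-x) ^ (A + 1) * q ^ (A + 2).choose 2 * q ^ (M + 1) *
      qRising q q (M + 1 + A)) * hA
  linear_combination -h - e

/-- Both sides satisfy X_{N+2} = (u + v) X_{N+1} - uv (1 - q^{N+1}) X_N. The first-step relation
`kappaSeries_one` has a constant term, and the weight u/v is what makes the two constants cancel at
N = 1. -/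
theorem kappaSeries_combination {q u v : ℂ} (hq : ‖q‖ < 1) (hu : u ≠ 0) (hv : v ≠ 0) (N : ℕ) :
    v ^ N * kappaSeries q (v / u) N - u / v * (u ^ N * kappaSeries q (u / v) N) =
      (partialTheta q (v / u) - u / v * partialTheta q (u / v)) *
        (qRising q q N * rogersSzego q u v N) := by
  induction N using Nat.twoStepInduction with
  | zero => simp [kappaSeries_zero hq, qRising_zero, rogersSzego_zero]
  | one =>
    have h1 := kappaSeries_one hq (v / u)
    have h2 := kappaSeries_one hq (u / v)
    rw [kappaSeries_zero hq] at h1 h2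
    have h3 := rogersSzego_one hq u v
    rw [qRising_succ, qRising_zero, pow_zero, one_mul, mul_one, h3]
    have h1' : v * kappaSeries q (v / u) 1 = (u + v) * partialTheta q (v / u) - u := by
      field_simp at h1
      linear_combination h1
    have h2' : u * kappaSeries q (u / v) 1 = (u + v) * partialTheta q (u / v) - v := by
      field_simp at h2
      linear_combination h2
    rw [pow_one, pow_one, h1', h2']
    field_simp
    ring
  | more N ih0 ih1 =>
    have step : ∀ {u v : ℂ}, u ≠ 0 → v ^ (N + 2) * kappaSeries q (v / u) (N + 2) =
        (u + v) * (v ^ (N + 1) * kappaSeries q (v / u) (N + 1)) -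
          u * v * (1 - q ^ (N + 1)) * (v ^ N * kappaSeries q (v / u) N) := fun {u v} hu => by
      have h := kappaSeries_succ_succ hq (v / u) N
      field_simp at h
      linear_combination v ^ (N + 1) * h
    have hr := rogersSzego_succ_succ hq u v N
    rw [step hu, step hv, qRising_succ q q (N + 1), qRising_succ q q N,
      show 1 - q * q ^ (N + 1) = 1 - q ^ (N + 2) by ring]
    rw [qRising_succ q q N] at ih1
    linear_combination (u + v) * ih1 - u * v * (1 - q ^ (N + 1)) * ih0 -
      (partialTheta q (v / u) - u / v * partialTheta q (u / v)) * (qRising q q N *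
        (1 - q * q ^ N)) * hr

/-- The double series `∑ (-α)^N (-β)^A q^{N(N+1)/2 + A(A+1)/2} (q)_{N+A} / ((q)_N (q)_A)`. -/
noncomputable def kernelSeries (q α β : ℂ) : ℂ :=
  ∑' N : ℕ, (-α) ^ N * q ^ (N + 1).choose 2 / qRising q q N * kappaSeries q β N

theorem summable_kernelSeries {q : ℂ} (hq : ‖q‖ < 1) (α β : ℂ) :
    Summable fun p : ℕ × ℕ => (-α) ^ p.1 * q ^ (p.1 + 1).choose 2 / qRising q q p.1 *
      ((-β) ^ p.2 * q ^ (p.2 + 1).choose 2 * qRisingRatio q p.1 p.2) := by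
  obtain ⟨C, h0, hC⟩ := exists_norm_qRisingRatio_le hq
  refine summable_prod_of_norm_le (C := C)
    (f := fun n => (-α) ^ n * q ^ (n + 1).choose 2 / qRising q q n)
    (g := fun n => (-β) ^ n * q ^ (n + 1).choose 2)
    (summable_norm_mul_of_bounded (summable_norm_partialTheta hq _)
      (exists_norm_inv_qRising_le hq (self_mul_pow_ne_one hq)))
    (summable_norm_partialTheta hq _) fun m n => ?_
  rw [← mul_assoc, norm_mul _ (qRisingRatio q m n), norm_mul, mul_comm C]
  exact mul_le_mul_of_nonneg_left (hC _ _) (by positivity)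

theorem kernelSeries_eq_tsum_tsum (q α β : ℂ) :
    kernelSeries q α β = ∑' N : ℕ, ∑' A : ℕ, (-α) ^ N * q ^ (N + 1).choose 2 / qRising q q N *
      ((-β) ^ A * q ^ (A + 1).choose 2 * qRisingRatio q N A) :=
  tsum_congr fun N => by rw [kappaSeries, tsum_mul_left]

theorem kernelSeries_comm {q : ℂ} (hq : ‖q‖ < 1) (α β : ℂ) :
    kernelSeries q α β = kernelSeries q β α := by
  rw [kernelSeries_eq_tsum_tsum, kernelSeries_eq_tsum_tsum,
    ← Summable.tsum_comm
    (f := fun N A => (-α) ^ N * q ^ (N + 1).choose 2 / qRising q q N *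
      ((-β) ^ A * q ^ (A + 1).choose 2 * qRisingRatio q N A)) (summable_kernelSeries hq α β)]
  refine tsum_congr fun m => tsum_congr fun n => ?_
  rw [qRisingRatio, qRisingRatio, add_comm n m]
  ring

theorem summable_kernelSeries_outer {q : ℂ} (hq : ‖q‖ < 1) (α β : ℂ) :
    Summable fun N : ℕ => (-α) ^ N * q ^ (N + 1).choose 2 / qRising q q N * kappaSeries q β N :=
  (summable_kernelSeries hq α β).prod.congr fun N => by rw [kappaSeries, ← tsum_mul_left]

/-- The triple product turns the theta factor into the combination of partial theta functions in
`kappaSeries_combination`, which is then applied to each Rogers–Szegő coefficient of ψ. -/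
theorem mul_psiSeries_eq {q u v : ℂ} (hq0 : q ≠ 0) (hq : ‖q‖ < 1) (hu : u ≠ 0) (hv : v ≠ 0) :
    qRisingInf q q * thetaProd q (u / v) * psiSeries q (q * u) (q * v) =
      kernelSeries q v (v / u) - u / v * kernelSeries q u (u / v) := by
  rw [qRisingInf_mul_thetaProd hq0 hq (div_ne_zero hu hv), one_div_div, psiSeries_eq_tsum hq,
    kernelSeries, kernelSeries, ← tsum_mul_left, ← tsum_mul_left, ← Summable.tsum_sub
    (summable_kernelSeries_outer hq v (v / u))
    ((summable_kernelSeries_outer hq u (u / v)).mul_left (u / v))]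
  refine tsum_congr fun N => ?_
  have h := kappaSeries_combination hq hu hv N
  have h0 := qRising_self_ne_zero hq N
  rw [rogersSzego_mul, pow_choose_two_succ, neg_pow u, neg_pow v]
  have e : (-1) ^ N * v ^ N * (q ^ N * q ^ N.choose 2) / qRising q q N * kappaSeries q (v / u) N -
      u / v * ((-1) ^ N * u ^ N * (q ^ N * q ^ N.choose 2) / qRising q q N *
        kappaSeries q (u / v) N) = (-1) ^ N * (q ^ N * q ^ N.choose 2) / qRising q q N *
      (v ^ N * kappaSeries q (v / u) N - u / v * (u ^ N * kappaSeries q (u / v) N)) := by ring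
  rw [e, h]
  field_simp

/-- The three-term relation for `psiSeries`. -/
theorem thetaProd_mul_psiSeries_cyclic {q e₁ e₂ e₃ : ℂ} (hq0 : q ≠ 0) (hq : ‖q‖ < 1)
    (h₁ : e₁ ≠ 0) (h₂ : e₂ ≠ 0) (h₃ : e₃ ≠ 0) :
    e₂ * thetaProd q (e₁ / e₂) * psiSeries q (q * (e₁ / e₃)) (q * (e₂ / e₃)) +
      e₃ * thetaProd q (e₂ / e₃) * psiSeries q (q * (e₂ / e₁)) (q * (e₃ / e₁)) +
      e₁ * thetaProd q (e₃ / e₁) * psiSeries q (q * (e₃ / e₂)) (q * (e₁ / e₂)) = 0 := by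
  -- In this form the cyclic sum telescopes: each b K(b/c, b/a) meets -b K(b/a, b/c), where K is the
  -- symmetric `kernelSeries`.
  have key : ∀ {a b c : ℂ}, a ≠ 0 → b ≠ 0 → c ≠ 0 → qRisingInf q q *
      (b * thetaProd q (a / b) * psiSeries q (q * (a / c)) (q * (b / c))) =
      b * kernelSeries q (b / c) (b / a) - a * kernelSeries q (a / c) (a / b) :=
    fun {a b c} ha hb hc => by
      have h := mul_psiSeries_eq hq0 hq (div_ne_zero ha hc) (div_ne_zero hb hc)
      rw [div_div_div_cancel_right₀ hc, div_div_div_cancel_right₀ hc] at h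
      have hab : a / b * b = a := div_mul_cancel₀ a hb
      linear_combination b * h - kernelSeries q (a / c) (a / b) * hab
  refine (mul_eq_zero.1 ?_).resolve_left (qRisingInf_self_ne_zero hq)
  rw [mul_add, mul_add, key h₁ h₂ h₃, key h₂ h₃ h₁, key h₃ h₁ h₂,
    kernelSeries_comm hq (e₂ / e₃), kernelSeries_comm hq (e₃ / e₁), kernelSeries_comm hq (e₁ / e₂)]
  ring

theorem thetaProd_inv {q x : ℂ} (hq0 : q ≠ 0) (hq : ‖q‖ < 1) (hx : x ≠ 0) :
    x * thetaProd q (1 / x) = -thetaProd q x := by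
  rw [thetaProd, thetaProd, qRisingInf_eq_one_sub_mul (1 / x) hq, qRisingInf_eq_one_sub_mul x hq,
    show q / (1 / x) = x * q by field_simp, show 1 / x * q = q / x by ring]
  field_simp
  ring

/-- The connection formula between the solutions of the `q`-Airy-type equation at `0` and `∞`. -/
theorem connection_formula {q w y : ℂ} (hq0 : q ≠ 0) (hq : ‖q‖ < 1) (hw : w ≠ 0) (hy : y ≠ 0) :
    thetaProd q (w ^ 2) * psiSeries q (q / (y * w)) (q * w / y) =
      thetaProd q (y * w) * psiSeries q (q / w ^ 2) (q * y / w) -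
        w ^ 2 * thetaProd q (y / w) * psiSeries q (q * w ^ 2) (q * y * w) := by
  -- The triple (w, w⁻¹, y); only the theta product at 1/(yw) then has to be inverted.
  have h := thetaProd_mul_psiSeries_cyclic hq0 hq hw (inv_ne_zero hw) hy
  have hi := thetaProd_inv hq0 hq (mul_ne_zero hy hw)
  rw [psiSeries_comm hq (q * (w / y)), psiSeries_comm hq (q * (y / w⁻¹)),
    show w / w⁻¹ = w ^ 2 by field_simp, show q * (w⁻¹ / y) = q / (y * w) by field_simp,
    show q * (w / y) = q * w / y by ring, show w⁻¹ / y = 1 / (y * w) by field_simp,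
    show q * (w⁻¹ / w) = q / w ^ 2 by field_simp, show q * (y / w) = q * y / w by ring,
    show q * (y / w⁻¹) = q * y * w by field_simp] at h
  have hw' : w * w⁻¹ = 1 := mul_inv_cancel₀ hw
  linear_combination w * h - psiSeries q (q / w ^ 2) (q * y / w) * hi -
    thetaProd q (w ^ 2) * psiSeries q (q / (y * w)) (q * w / y) * hw'

theorem thetaProd_shift {q x : ℂ} (hq0 : q ≠ 0) (hq : ‖q‖ < 1) (hx : x ≠ 0) (n : ℕ) :
    thetaProd q (x * q ^ n) * ((-x) ^ n * q ^ n.choose 2) = thetaProd q x := by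
  induction n with
  | zero => simp
  | succ n ih =>
    have hy : x * q ^ n ≠ 0 := mul_ne_zero hx (pow_ne_zero _ hq0)
    have step : thetaProd q (x * q ^ n * q) * (-(x * q ^ n)) = thetaProd q (x * q ^ n) := by
      have e : q / (x * q ^ n * q) = 1 / (x * q ^ n) := by field_simp
      rw [thetaProd, thetaProd, e, qRisingInf_eq_one_sub_mul (x * q ^ n) hq,
        qRisingInf_eq_one_sub_mul (1 / (x * q ^ n)) hq,
        show 1 / (x * q ^ n) * q = q / (x * q ^ n) by ring]
      generalize x * q ^ n = y at *
      field_simp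
      ring
    rw [← ih, ← step, pow_choose_two_succ, show x * q ^ (n + 1) = x * q ^ n * q by ring]
    ring

theorem thetaProd_ne_zero {q x : ℂ} (hq0 : q ≠ 0) (hq : ‖q‖ < 1)
    (h : ∀ m : ℤ, x ≠ q ^ m) : thetaProd q x ≠ 0 := by
  have hx : x ≠ 0 ∨ x = 0 := (eq_or_ne x 0).symm
  refine mul_ne_zero (qRisingInf_ne_zero hq fun n hn => h (-n) ?_)
    (qRisingInf_ne_zero hq fun n hn => ?_)
  · rw [zpow_neg, zpow_natCast]
    exact eq_inv_of_mul_eq_one_left hn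
  -- At x = 0 the convention q / 0 = 0 makes the second product 1.
  · rcases hx with hx | rfl
    · refine h (n + 1) ?_
      rw [zpow_add₀ hq0, zpow_natCast, zpow_one]
      field_simp at hn
      rw [← hn]; ring
    · simp at hn

/-! ### Absolute convergence of the double series behind the q-integral. -/

theorem exists_norm_qRisingInf_mul_pow_le (a : ℂ) {q : ℂ} (hq : ‖q‖ < 1) :
    ∃ C : ℝ, 0 < C ∧ ∀ n : ℕ, ‖qRisingInf (a * q ^ n) q‖ ≤ C := by
  have h := tendsto_tsum_mul_pow hq (fun n => (-1) ^ n * q ^ n.choose 2 / qRising q q n) a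
    ((summable_norm_euler hq (-a)).congr fun n => by congr 1; rw [neg_pow a]; ring)
  obtain ⟨C, hC⟩ := (Metric.isBounded_range_of_tendsto _ h).exists_norm_le
  refine ⟨max C 1, by positivity, fun n => ?_⟩
  rw [qRisingInf_eq_tsum hq]
  refine le_trans (le_of_eq ?_) ((hC _ ⟨n, rfl⟩).trans (le_max_left C 1))
  congr 1
  exact tsum_congr fun m => by rw [neg_pow (a * q ^ n)]; ring

/-- A summable majorant for the double series `∑ A^n D^j q^{n(n-1)/2 + j(j-1)/2 - nj}`. -/
noncomputable def diagonalBound (ρ τ x : ℝ) (n j : ℕ) : ℝ :=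
  if j ≤ n then x ^ (n - j) * ρ ^ (n - j).choose 2 * τ ^ j else 0

theorem diagonalBound_nonneg {ρ τ x : ℝ} (h0 : 0 ≤ ρ) (t0 : 0 ≤ τ) (hx : 0 ≤ x) (n j : ℕ) :
    0 ≤ diagonalBound ρ τ x n j := by
  rw [diagonalBound]
  split_ifs <;> positivity

/-- The substitution n = r + j turns the sum over j ≤ n into a product of two convergent series. -/
theorem summable_diagonal {ρ τ : ℝ} (h0 : 0 ≤ ρ) (h1 : ρ < 1) (t0 : 0 ≤ τ) (t1 : τ < 1) {x : ℝ}
    (hx : 0 ≤ x) : Summable fun p : ℕ × ℕ =>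
      diagonalBound ρ τ x p.1 p.2 := by
  have hi : Function.Injective fun p : ℕ × ℕ => (p.1 + p.2, p.2) := fun p r h => by
    simp only [Prod.mk.injEq] at h
    exact Prod.ext (by omega) h.2
  rw [← hi.summable_iff (f := fun p : ℕ × ℕ => diagonalBound ρ τ x p.1 p.2) fun p hp => if_neg fun hle => hp ⟨(p.1 - p.2, p.2), by
    simp only [Nat.sub_add_cancel hle]⟩]
  refine ((summable_pow_mul_pow_choose h0 h1 x).mul_of_nonneg
    (summable_geometric_of_lt_one t0 t1) (fun n => by positivity)
    (fun n => by positivity)).congr fun p => ?_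
  simp [diagonalBound]

/-- On n = r + j the exponent n(n-1)/2 + j(j-1)/2 - nj equals r(r-1)/2 - j. There is thus no
Gaussian decay along the diagonal, only geometric decay of ratio AD/q. -/
theorem pow_mul_pow_diagonal {q : ℂ} (hq0 : q ≠ 0) (A D : ℂ) (j r : ℕ) :
    A ^ (r + j) * q ^ (r + j).choose 2 * (D ^ j * q ^ j.choose 2) * (q ^ ((r + j) * j))⁻¹ =
      A ^ r * q ^ r.choose 2 * (A * D / q) ^ j := by
  have h := pow_choose_two_mul_succ q j
  rw [pow_choose_two_succ] at h
  rw [pow_choose_two_add, add_mul, pow_add q (r * j), ← h, div_pow, mul_pow, pow_add]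
  have h1 : q ^ j.choose 2 ≠ 0 := pow_ne_zero _ hq0
  field_simp

theorem norm_pow_mul_pow_of_le {q : ℂ} (hq0 : q ≠ 0) (A D : ℂ) {n j : ℕ} (h : j ≤ n) :
    ‖A ^ n * q ^ n.choose 2 * (D ^ j * q ^ j.choose 2) * (q ^ (n * j))⁻¹‖ =
      diagonalBound ‖q‖ ‖A * D / q‖ ‖A‖ n j := by
  rw [diagonalBound, if_pos h]
  obtain ⟨r, rfl⟩ : ∃ r, n = r + j := ⟨n - j, by omega⟩
  rw [pow_mul_pow_diagonal hq0, Nat.add_sub_cancel]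
  simp only [norm_mul, norm_pow]

/-- The term is symmetric under exchanging (A, n) with (D, j), so one majorant serves each side of
the diagonal. -/
theorem norm_pow_mul_pow_le {q : ℂ} (hq0 : q ≠ 0) (A D : ℂ) (n j : ℕ) :
    ‖A ^ n * q ^ n.choose 2 * (D ^ j * q ^ j.choose 2) * (q ^ (n * j))⁻¹‖ ≤
      diagonalBound ‖q‖ ‖A * D / q‖ ‖A‖ n j + diagonalBound ‖q‖ ‖A * D / q‖ ‖D‖ j n := by
  have h1 := diagonalBound_nonneg (norm_nonneg q) (norm_nonneg (A * D / q)) (norm_nonneg A) n j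
  have h2 := diagonalBound_nonneg (norm_nonneg q) (norm_nonneg (A * D / q)) (norm_nonneg D) j n
  rcases le_total j n with hle | hle
  · rw [norm_pow_mul_pow_of_le hq0 A D hle]
    exact le_add_of_nonneg_right h2
  · rw [mul_comm (A ^ n * q ^ n.choose 2), mul_comm n j, norm_pow_mul_pow_of_le hq0 D A hle,
      mul_comm D A]
    exact le_add_of_nonneg_left h1

/-- Absolute convergence of the double series behind the expansion of the Jackson integral. -/
theorem summable_bilateral {q A D : ℂ} (hq0 : q ≠ 0) (hq : ‖q‖ < 1) (h : ‖A * D / q‖ < 1)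
    {f g : ℕ → ℂ} (hf : ∃ C : ℝ, 0 < C ∧ ∀ n, ‖f n‖ ≤ C) (hg : ∃ C : ℝ, 0 < C ∧ ∀ n, ‖g n‖ ≤ C) :
    Summable fun p : ℕ × ℕ => A ^ p.1 * q ^ p.1.choose 2 * f p.1 *
      (D ^ p.2 * q ^ p.2.choose 2 * g p.2) * (q ^ (p.1 * p.2))⁻¹ := by
  obtain ⟨B, hB0, hB⟩ := hf
  obtain ⟨C, hC0, hC⟩ := hg
  have s1 := summable_diagonal (norm_nonneg q) hq (norm_nonneg _) h (norm_nonneg A)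
  have s2 := (summable_diagonal (norm_nonneg q) hq (norm_nonneg _) h
    (norm_nonneg D)).comp_injective Prod.swap_injective
  refine Summable.of_norm_bounded ((s1.add s2).mul_left (B * C)) fun p => ?_
  have e : A ^ p.1 * q ^ p.1.choose 2 * f p.1 * (D ^ p.2 * q ^ p.2.choose 2 * g p.2) *
      (q ^ (p.1 * p.2))⁻¹ = f p.1 * g p.2 *
        (A ^ p.1 * q ^ p.1.choose 2 * (D ^ p.2 * q ^ p.2.choose 2) * (q ^ (p.1 * p.2))⁻¹) := by
    ring
  rw [e, norm_mul, norm_mul]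
  exact mul_le_mul (mul_le_mul (hB _) (hC _) (norm_nonneg _) hB0.le)
    (norm_pow_mul_pow_le hq0 A D p.1 p.2) (norm_nonneg _) (by positivity)

/-- The double series behind the expansion of the Jackson integral. -/
noncomputable def jacksonTerm (q w A D : ℂ) (p : ℕ × ℕ) : ℂ :=
  (-A) ^ p.1 * q ^ p.1.choose 2 * (qRisingInf (q * w ^ 2 * q ^ p.1) q / qRising q q p.1) *
    ((-D) ^ p.2 * q ^ p.2.choose 2 * (qRising q q p.2)⁻¹) * (q ^ (p.1 * p.2))⁻¹

theorem summable_jacksonTerm {q A D : ℂ} (hq0 : q ≠ 0) (hq : ‖q‖ < 1) (h : ‖A * D / q‖ < 1)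
    (w : ℂ) : Summable (jacksonTerm q w A D) := by
  obtain ⟨B, hB0, hB⟩ := exists_norm_qRisingInf_mul_pow_le (q * w ^ 2) hq
  obtain ⟨C, hC0, hC⟩ := exists_norm_inv_qRising_le hq (self_mul_pow_ne_one hq)
  refine summable_bilateral hq0 hq (A := -A) (D := -D) (by rwa [neg_mul_neg])
    (f := fun n => qRisingInf (q * w ^ 2 * q ^ n) q / qRising q q n)
    (g := fun n => (qRising q q n)⁻¹) ⟨B * C, by positivity, fun n => ?_⟩ ⟨C, hC0, hC⟩
  rw [div_eq_mul_inv, norm_mul]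
  exact mul_le_mul (hB n) (hC n) (norm_nonneg _) hB0.le

theorem tsum_jacksonTerm_right {q : ℂ} (hq : ‖q‖ < 1) (w A D : ℂ) (n : ℕ) :
    ∑' j, jacksonTerm q w A D (n, j) = (-A) ^ n * q ^ n.choose 2 *
      (qRisingInf (q * w ^ 2 * q ^ n) q / qRising q q n) * qRisingInf (D / q ^ n) q := by
  rw [qRisingInf_eq_tsum hq (D / q ^ n), ← tsum_mul_left]
  refine tsum_congr fun j => ?_
  rw [jacksonTerm, ← neg_div, div_pow, ← pow_mul]
  ring

theorem tsum_jacksonTerm_left (q w A D : ℂ) (j : ℕ) :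
    ∑' n, jacksonTerm q w A D (n, j) = (-D) ^ j * q ^ j.choose 2 / qRising q q j *
      psiSeries q (q * w ^ 2) (A / q ^ j) := by
  rw [psiSeries, ← tsum_mul_left]
  refine tsum_congr fun n => ?_
  rw [jacksonTerm, ← neg_div, div_pow (-A), ← pow_mul, mul_comm j n]
  ring

/-! ### Expansion of one half of the q-integral. -/

theorem expI_neg (θ : ℂ) : expI (-θ) = (expI θ)⁻¹ := by
  rw [expI, expI, mul_neg, Complex.exp_neg]

theorem expI_ne_zero (θ : ℂ) : expI θ ≠ 0 := Complex.exp_ne_zero _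

theorem expI_natCast_mul (k : ℕ) (θ : ℂ) : expI (k * θ) = expI θ ^ k := by
  rw [expI, expI, ← Complex.exp_nat_mul]
  congr 1
  ring

theorem expI_two_mul (θ : ℂ) : expI (2 * θ) = expI θ ^ 2 := by
  exact_mod_cast expI_natCast_mul 2 θ

theorem pIntegrand_neg (q b c lam θ : ℂ) (k : ℕ) :
    pIntegrand q b c lam (-θ) k = pIntegrand q b c lam θ k := by
  funext t
  rw [pIntegrand, pIntegrand, neg_neg, mul_comm (qRisingInf (2 * q * expI (-θ) * t) q)]

/-- Quasi-periodicity trades the theta product at 2cw q^n for the one at 2cw times (-2cw)^n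
q^{n(n-1)/2}. The weight q^n and the factor q^{nk} of t^k are absorbed into A, and (q^{n+1}; q)_∞ =
(q; q)_∞ / (q; q)_n. -/
theorem pow_mul_pIntegrand {q b c lam θ : ℂ} (hq0 : q ≠ 0) (hq : ‖q‖ < 1) (hb : b ≠ 0) (hc : c ≠ 0)
    (hcθ : ∀ m : ℤ, 2 * c * expI θ ≠ q ^ m) (k n : ℕ) :
    q ^ n * pIntegrand q b c lam θ k (expI θ / 2 * q ^ n) =
      (expI θ / 2) ^ k * qRisingInf q q / thetaProd q (2 * c * expI θ) *
        ∑' j, jacksonTerm q (expI θ) (2 * c * expI θ * q ^ (k + 1))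
          (-(lam * q / (2 * b * c)) / expI θ) (n, j) := by
  have hw := expI_ne_zero θ
  have hx : 2 * c * expI θ ≠ 0 := mul_ne_zero (mul_ne_zero two_ne_zero hc) hw
  have ht := thetaProd_ne_zero hq0 hq hcθ
  have hs := thetaProd_shift hq0 hq hx n
  have hqn : q ^ n ≠ 0 := pow_ne_zero n hq0
  rw [tsum_jacksonTerm_right hq, pIntegrand, expI_neg]
  rw [show 2 * q * expI θ * (expI θ / 2 * q ^ n) = q * expI θ ^ 2 * q ^ n by ring,
    show 2 * q * (expI θ)⁻¹ * (expI θ / 2 * q ^ n) = q * q ^ n by field_simp,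
    show -(lam * q) / (4 * b * c * (expI θ / 2 * q ^ n)) =
      -(lam * q / (2 * b * c)) / expI θ / q ^ n by field_simp; ring,
    show 4 * c * (expI θ / 2 * q ^ n) = 2 * c * expI θ * q ^ n by ring]
  have hI : qRisingInf q q = qRising q q n * qRisingInf (q * q ^ n) q := qRisingInf_eq_mul q hq n
  have hP := qRising_self_ne_zero hq n
  have hI' : qRisingInf (q * q ^ n) q = qRisingInf q q / qRising q q n := by
    rw [hI]; field_simp
  have ht' : thetaProd q (2 * c * expI θ * q ^ n) ≠ 0 := fun h0 => ht (by rw [← hs, h0, zero_mul])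
  rw [hI', ← thetaProd, mul_pow (expI θ / 2), ← hs, neg_pow (2 * c * expI θ * q ^ (k + 1)),
    neg_pow (2 * c * expI θ), mul_pow (2 * c * expI θ), ← pow_mul, ← pow_mul]
  have hA : (2 * c * expI θ) ^ n ≠ 0 := pow_ne_zero _ hx
  have hC : q ^ n.choose 2 ≠ 0 := pow_ne_zero _ hq0
  have h1 : ((-1 : ℂ)) ^ n ≠ 0 := pow_ne_zero _ (by norm_num)
  rw [show (k + 1) * n = n * k + n by ring, pow_add]
  generalize (2 * c * expI θ) ^ n = X at *
  generalize thetaProd q (2 * c * expI θ * q ^ n) = T at *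
  field_simp

/-- The diagonal ratio AD/q is -q^k λq/b: this is where |λq/b| < 1 enters. -/
theorem norm_jackson_lt_one {q b c lam w : ℂ} (hq0 : q ≠ 0) (hq : ‖q‖ < 1) (hb : b ≠ 0)
    (hc : c ≠ 0) (hw : w ≠ 0) (hlam : ‖lam * q / b‖ < 1) (k : ℕ) :
    ‖2 * c * w * q ^ (k + 1) * (-(lam * q / (2 * b * c)) / w) / q‖ < 1 := by
  have e : 2 * c * w * q ^ (k + 1) * (-(lam * q / (2 * b * c)) / w) / q =
      -(q ^ k * (lam * q / b)) := by
    rw [pow_succ]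
    field_simp
  rw [e, norm_neg, norm_mul, norm_pow]
  exact mul_lt_one_of_nonneg_of_lt_one_right (pow_le_one₀ (norm_nonneg _) hq.le) (norm_nonneg _)
    hlam

theorem summable_pow_mul_pIntegrand {q b c lam θ : ℂ} (hq0 : q ≠ 0) (hq : ‖q‖ < 1) (hb : b ≠ 0)
    (hc : c ≠ 0) (hcθ : ∀ m : ℤ, 2 * c * expI θ ≠ q ^ m) (hlam : ‖lam * q / b‖ < 1) (k : ℕ) :
    Summable fun n : ℕ => q ^ n * pIntegrand q b c lam θ k (expI θ / 2 * q ^ n) := by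
  simp only [pow_mul_pIntegrand hq0 hq hb hc hcθ]
  exact (summable_jacksonTerm hq0 hq
    (norm_jackson_lt_one hq0 hq hb hc (expI_ne_zero θ) hlam k) (expI θ)).prod.mul_left _

theorem tsum_pow_mul_pIntegrand {q b c lam θ : ℂ} (hq0 : q ≠ 0) (hq : ‖q‖ < 1) (hb : b ≠ 0)
    (hc : c ≠ 0) (hcθ : ∀ m : ℤ, 2 * c * expI θ ≠ q ^ m) (hlam : ‖lam * q / b‖ < 1) (k : ℕ) :
    ∑' n : ℕ, q ^ n * pIntegrand q b c lam θ k (expI θ / 2 * q ^ n) =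
      (expI θ / 2) ^ k * qRisingInf q q / thetaProd q (2 * c * expI θ) *
        ∑' j : ℕ, (-(-(lam * q / (2 * b * c)) / expI θ)) ^ j * q ^ j.choose 2 / qRising q q j *
          psiSeries q (q * expI θ ^ 2) (2 * c * expI θ * q ^ (k + 1) / q ^ j) := by
  have hs := summable_jacksonTerm hq0 hq
    (norm_jackson_lt_one hq0 hq hb hc (expI_ne_zero θ) hlam k) (expI θ)
  simp only [pow_mul_pIntegrand hq0 hq hb hc hcθ]
  rw [tsum_mul_left, ← Summable.tsum_comm (f := fun n j => jacksonTerm q (expI θ)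
    (2 * c * expI θ * q ^ (k + 1)) (-(lam * q / (2 * b * c)) / expI θ) (n, j)) hs]
  simp only [tsum_jacksonTerm_left]

theorem summable_jackson_expansion {q b c lam w : ℂ} (hq0 : q ≠ 0) (hq : ‖q‖ < 1) (hb : b ≠ 0)
    (hc : c ≠ 0) (hw : w ≠ 0) (hlam : ‖lam * q / b‖ < 1) (k : ℕ) :
    Summable fun j : ℕ => (-(-(lam * q / (2 * b * c)) / w)) ^ j * q ^ j.choose 2 / qRising q q j *
      psiSeries q (q * w ^ 2) (2 * c * w * q ^ (k + 1) / q ^ j) := by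
  have hs := summable_jacksonTerm hq0 hq (norm_jackson_lt_one hq0 hq hb hc hw hlam k) w
  refine ((Equiv.prodComm ℕ ℕ).summable_iff.2 hs).prod.congr fun j => ?_
  rw [← tsum_jacksonTerm_left]
  rfl

/-! ### Series transformations leading to the ₂φ₁. -/

/-- The iterated series `∑_j (D v)^j q^{j(j-1)} / (q; q)_j · psiSeries q (u q^j) (v q^j)` collapses
to a single one. -/
theorem tsum_psiSeries_eq {q : ℂ} (hq : ‖q‖ < 1) (D u v : ℂ) :
    ∑' j : ℕ, (D * v) ^ j * (q ^ j.choose 2 * q ^ j.choose 2) / qRising q q j *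
        psiSeries q (u * q ^ j) (v * q ^ j) =
      ∑' M : ℕ, qRising D q M * ((-v) ^ M * q ^ M.choose 2 / qRising q q M) *
        qRisingInf (u * q ^ M) q := by
  obtain ⟨C, hC0, hC⟩ := exists_norm_qRisingInf_mul_pow_le u hq
  have hF : Summable fun p : ℕ × ℕ =>
      (D * v) ^ p.1 * (q ^ p.1.choose 2 * q ^ p.1.choose 2) / qRising q q p.1 *
        ((-(v * q ^ p.1)) ^ p.2 * q ^ p.2.choose 2 / qRising q q p.2 *
          qRisingInf (u * q ^ (p.1 + p.2)) q) := by
    refine summable_prod_of_norm_le (C := C) (summable_norm_euler hq (D * v))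
      (summable_norm_euler hq v) fun m n => ?_
    have e : (D * v) ^ m * (q ^ m.choose 2 * q ^ m.choose 2) / qRising q q m *
        ((-(v * q ^ m)) ^ n * q ^ n.choose 2 / qRising q q n * qRisingInf (u * q ^ (m + n)) q) =
        qRisingInf (u * q ^ (m + n)) q * ((D * v) ^ m * q ^ m.choose 2 / qRising q q m *
          (v ^ n * q ^ n.choose 2 / qRising q q n)) * ((-1) ^ n * (q ^ m.choose 2 * q ^ (m * n))) := by
      rw [neg_pow (v * q ^ m), mul_pow v, ← pow_mul]
      ring
    simp only
    rw [e, norm_mul, norm_mul (qRisingInf _ _), norm_mul (_ / _)]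
    refine le_trans (mul_le_of_le_one_right (by positivity) ?_)
      (mul_le_mul_of_nonneg_right (hC _) (by positivity))
    rw [norm_mul, norm_mul, norm_pow, norm_neg, norm_one, one_pow, one_mul, norm_pow, norm_pow]
    exact mul_le_one₀ (pow_le_one₀ (norm_nonneg _) hq.le) (by positivity)
      (pow_le_one₀ (norm_nonneg _) hq.le)
  have h1 : ∀ j : ℕ, (D * v) ^ j * (q ^ j.choose 2 * q ^ j.choose 2) / qRising q q j *
      psiSeries q (u * q ^ j) (v * q ^ j) = ∑' m : ℕ,
        (D * v) ^ j * (q ^ j.choose 2 * q ^ j.choose 2) / qRising q q j *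
        ((-(v * q ^ j)) ^ m * q ^ m.choose 2 / qRising q q m *
          qRisingInf (u * q ^ (j + m)) q) := fun j => by
    rw [psiSeries, ← tsum_mul_left]
    exact tsum_congr fun m => by rw [pow_add, ← mul_assoc u]
  simp only [h1]
  rw [tsum_tsum_eq_tsum_sum_antidiagonal hF]
  refine tsum_congr fun M => ?_
  -- Along j + m = M the infinite product depends on M alone, so the inner sum is the finite
  -- q-binomial expansion of (D; q)_M.
  have hR := sum_antidiagonal_rothe hq D M
  rw [show qRising D q M * ((-v) ^ M * q ^ M.choose 2 / qRising q q M) * qRisingInf (u * q ^ M) q =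
    (-v) ^ M * q ^ M.choose 2 * qRisingInf (u * q ^ M) q * (qRising D q M / qRising q q M) by ring,
    ← hR, mul_sum]
  refine sum_congr rfl fun p hp => ?_
  rw [← mem_antidiagonal.1 hp, pow_choose_two_add, neg_pow (v * q ^ p.1), mul_pow v, ← pow_mul,
    pow_add (-v), neg_pow v, neg_pow v, neg_pow D, mul_pow D]
  have h2 : ((-1 : ℂ)) ^ p.1 * (-1) ^ p.1 = 1 := by rw [← mul_pow]; norm_num
  linear_combination (-(v ^ p.1 * (-1) ^ p.2 * v ^ p.2 * (q ^ p.1.choose 2 * q ^ p.2.choose 2 *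
    q ^ (p.1 * p.2)) * qRisingInf (u * q ^ (p.1 + p.2)) q * (D ^ p.1 * q ^ p.1.choose 2 /
    qRising q q p.1 * (1 / qRising q q p.2)))) * h2

/-- A transformation of `₂φ₁(α, 0; v; q, D)`. -/
theorem qRisingInf_mul_tsum_eq {q D : ℂ} (hq : ‖q‖ < 1) (hD : ‖D‖ < 1) (α v : ℂ) :
    qRisingInf D q * ∑' n : ℕ, qRising α q n / qRising q q n * D ^ n * qRisingInf (v * q ^ n) q =
      ∑' M : ℕ, qRising D q M * ((-v) ^ M * q ^ M.choose 2 / qRising q q M) *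
        qRisingInf (α * D * q ^ M) q := by
  have hF : Summable fun p : ℕ × ℕ => qRising α q p.1 / qRising q q p.1 * D ^ p.1 *
      ((-(v * q ^ p.1)) ^ p.2 * q ^ p.2.choose 2 / qRising q q p.2) := by
    refine summable_prod_of_norm_le (C := 1) (summable_norm_qBinomial α hq hD)
      (summable_norm_euler hq v) fun m n => ?_
    rw [one_mul, norm_mul]
    refine mul_le_mul_of_nonneg_left ?_ (norm_nonneg _)
    simp only [norm_div, norm_mul, norm_pow, norm_neg]
    gcongr
    exact mul_le_of_le_one_right (norm_nonneg _) (pow_le_one₀ (norm_nonneg _) hq.le)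
  have h1 : ∀ n : ℕ, qRising α q n / qRising q q n * D ^ n * qRisingInf (v * q ^ n) q =
      ∑' m : ℕ, qRising α q n / qRising q q n * D ^ n *
      ((-(v * q ^ n)) ^ m * q ^ m.choose 2 / qRising q q m) := fun n => by
    rw [qRisingInf_eq_tsum hq, tsum_mul_left]
  simp only [h1]
  rw [← Summable.tsum_comm (f := fun n m => qRising α q n / qRising q q n * D ^ n *
      ((-(v * q ^ n)) ^ m * q ^ m.choose 2 / qRising q q m)) hF, ← tsum_mul_left]
  refine tsum_congr fun m => ?_
  have hDm : ‖D * q ^ m‖ < 1 := by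
    rw [norm_mul, norm_pow]
    exact (mul_le_of_le_one_right (norm_nonneg _) (pow_le_one₀ (norm_nonneg _) hq.le)).trans_lt hD
  -- After (v q^n; q)_∞ is expanded and the sums exchanged, the sum over n is a q-binomial series at
  -- D q^m.
  have h2 := tsum_qBinomial α hq hDm
  rw [qRisingInf_eq_mul D hq m, mul_assoc α, ← h2, ← tsum_mul_left, ← tsum_mul_right,
    ← tsum_mul_left]
  refine tsum_congr fun n => ?_
  rw [← neg_mul, mul_pow (-v), mul_pow D, ← pow_mul, ← pow_mul, mul_comm m n]
  ring

/-! ### Merging the two halves of the q-integral. -/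

theorem qIntegral_symm (q : ℂ) (f : ℂ → ℂ) (a b : ℂ) : qIntegral q f a b = -qIntegral q f b a := by
  rw [qIntegral, qIntegral]
  ring

/-- The sine and the exchange of endpoints each contribute a sign. -/
theorem pFun_neg (q b c lam θ : ℂ) (k : ℕ) : pFun q b c lam (-θ) k = pFun q b c lam θ k := by
  rw [pFun, pFun, pIntegrand_neg, neg_neg, qIntegral_symm, Complex.sin_neg,
    show 2 * -θ = -(2 * θ) by ring, neg_neg]
  ring

theorem neg_I_mul_sin (θ : ℂ) : -Complex.I * Complex.sin θ = ((expI θ)⁻¹ - expI θ) / 2 := by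
  rw [← expI_neg, expI, expI, Complex.sin]
  rw [show -θ * Complex.I = Complex.I * -θ by ring, show θ * Complex.I = Complex.I * θ by ring]
  linear_combination (-(Complex.exp (Complex.I * -θ) - Complex.exp (Complex.I * θ)) / 2) *
    Complex.I_mul_I

theorem pow_mul_choose_two_cancel {q : ℂ} (hq0 : q ≠ 0) (j : ℕ) :
    (q / q ^ j) ^ j * (q ^ j.choose 2 * q ^ j.choose 2) = 1 := by
  have h4 := pow_choose_two_mul_succ q j
  rw [pow_choose_two_succ] at h4
  rw [div_pow, ← pow_mul, ← h4]
  have : q ^ j.choose 2 ≠ 0 := pow_ne_zero _ hq0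
  field_simp

/-- Carries the theta product from 2cw to yw, y = 2c q^k / q^j, as `connection_formula` requires: k
shifts by q, then j shifts back. Apart from w^k the new coefficient is free of w, so the halves for
w and w⁻¹ share it. -/
theorem thetaProd_coeff {q c w d : ℂ} (hq0 : q ≠ 0) (hq : ‖q‖ < 1) (hc : c ≠ 0) (hw : w ≠ 0)
    (k j : ℕ) :
    thetaProd q (2 * c * w) * (-(d * w)) ^ j * q ^ j.choose 2 =
      w ^ k * (-(2 * c)) ^ k * q ^ k.choose 2 * ((d * (q / (2 * c * q ^ k))) ^ j *
        (q ^ j.choose 2 * q ^ j.choose 2)) * thetaProd q (2 * c * q ^ k / q ^ j * w) := by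
  have hx : 2 * c * w ≠ 0 := mul_ne_zero (mul_ne_zero two_ne_zero hc) hw
  have hqk : q ^ k ≠ 0 := pow_ne_zero _ hq0
  have hqj : q ^ j ≠ 0 := pow_ne_zero _ hq0
  have hy : 2 * c * q ^ k / q ^ j * w ≠ 0 :=
    mul_ne_zero (div_ne_zero (mul_ne_zero (mul_ne_zero two_ne_zero hc) hqk) hqj) hw
  have h1 := thetaProd_shift hq0 hq hx k
  have h2 := thetaProd_shift hq0 hq hy j
  rw [show 2 * c * q ^ k / q ^ j * w * q ^ j = 2 * c * w * q ^ k by field_simp] at h2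
  have h3 := pow_mul_choose_two_cancel hq0 j
  rw [show q / q ^ j = q / (2 * c * q ^ k) * (2 * c * q ^ k / q ^ j) by field_simp] at h3
  rw [← h1, ← h2, show -(2 * c * w) = w * -(2 * c) by ring, mul_pow w,
    show -(2 * c * q ^ k / q ^ j * w) = -w * (2 * c * q ^ k / q ^ j) by ring, mul_pow (-w),
    show -(d * w) = -w * d by ring, mul_pow (-w) d, mul_pow d]
  rw [mul_pow (q / (2 * c * q ^ k))] at h3
  linear_combination (-(thetaProd q (2 * c * w * q ^ k) * (w ^ k * (-(2 * c)) ^ k * q ^ k.choose 2) *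
    ((-w) ^ j * d ^ j) * q ^ j.choose 2)) * h3

/-- The `q`-integral as a single series. -/
theorem pFun_mul_eq {q b c lam θ : ℂ}
    (hq0 : q ≠ 0) (hq1 : ‖q‖ < 1) (hb : b ≠ 0) (hc : c ≠ 0)
    (hθ : ∀ m : ℤ, expI (2 * θ) ≠ q ^ m)
    (hcθ : ∀ m : ℤ, 2 * c * expI θ ≠ q ^ m)
    (hcθ' : ∀ m : ℤ, 2 * c * expI (-θ) ≠ q ^ m)
    (hlam : ‖lam * q / b‖ < 1) (k : ℕ) :
    pFun q b c lam θ k *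
        (qRisingInf (q / (2 * c * expI θ)) q * qRisingInf (q / (2 * c * (expI θ)⁻¹)) q) =
      (-c) ^ k * q ^ k.choose 2 * ∑' j : ℕ,
        (-(lam * q / (2 * b * c)) * (q / (2 * c * q ^ k))) ^ j * (q ^ j.choose 2 * q ^ j.choose 2) /
          qRising q q j * psiSeries q (q / (2 * c * q ^ k / q ^ j * expI θ))
            (q * expI θ / (2 * c * q ^ k / q ^ j)) := by
  have hw := expI_ne_zero θ
  have hsp := summable_jackson_expansion (lam := lam) hq0 hq1 hb hc hw hlam k
  have hsm := summable_jackson_expansion (lam := lam) hq0 hq1 hb hc (inv_ne_zero hw) hlam k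
  have hjp := tsum_pow_mul_pIntegrand hq0 hq1 hb hc hcθ hlam k
  have hjm := tsum_pow_mul_pIntegrand hq0 hq1 hb hc hcθ' hlam k
  have htp := thetaProd_ne_zero hq0 hq1 hcθ
  have htm := thetaProd_ne_zero hq0 hq1 hcθ'
  have htw : thetaProd q (expI θ ^ 2) ≠ 0 := thetaProd_ne_zero hq0 hq1 (by
    rwa [← expI_two_mul])
  rw [pIntegrand_neg, expI_neg] at hjm
  rw [expI_neg] at htm
  rw [pFun, qIntegral, expI_neg θ, hjp, hjm, expI_neg (2 * θ), expI_two_mul]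
  have hq1' : 1 - q ≠ 0 := sub_ne_zero.2 fun h => by rw [← h, norm_one] at hq1; exact hq1.false
  rw [show 4 * (-Complex.I * Complex.sin θ) = 2 * ((expI θ)⁻¹ - expI θ) by
    rw [neg_I_mul_sin]; ring]
  set w := expI θ with hwdef
  set d := -(lam * q / (2 * b * c)) with hd
  -- the connection formula, term by term
  have hcomb : w⁻¹ * (w⁻¹) ^ k * thetaProd q (2 * c * w) *
        (∑' j : ℕ, (-(d / w⁻¹)) ^ j * q ^ j.choose 2 / qRising q q j *
          psiSeries q (q * (w⁻¹) ^ 2) (2 * c * w⁻¹ * q ^ (k + 1) / q ^ j)) -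
      w * w ^ k * thetaProd q (2 * c * w⁻¹) *
        (∑' j : ℕ, (-(d / w)) ^ j * q ^ j.choose 2 / qRising q q j *
          psiSeries q (q * w ^ 2) (2 * c * w * q ^ (k + 1) / q ^ j)) =
      (-(2 * c)) ^ k * q ^ k.choose 2 * w⁻¹ * thetaProd q (w ^ 2) * ∑' j : ℕ,
        (d * (q / (2 * c * q ^ k))) ^ j * (q ^ j.choose 2 * q ^ j.choose 2) /
          qRising q q j * psiSeries q (q / (2 * c * q ^ k / q ^ j * w))
            (q * w / (2 * c * q ^ k / q ^ j)) := by
    rw [← tsum_mul_left, ← tsum_mul_left, ← tsum_mul_left, ← Summable.tsum_sub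
      (hsm.mul_left _) (hsp.mul_left _)]
    refine tsum_congr fun j => ?_
    have hqk : q ^ k ≠ 0 := pow_ne_zero _ hq0
    have hqj : q ^ j ≠ 0 := pow_ne_zero _ hq0
    have hy : 2 * c * q ^ k / q ^ j ≠ 0 :=
      div_ne_zero (mul_ne_zero (mul_ne_zero two_ne_zero hc) hqk) hqj
    have hconn := connection_formula hq0 hq1 hw hy
    have c1 := thetaProd_coeff (d := d) hq0 hq1 hc hw k j
    have c2 := thetaProd_coeff (d := d) hq0 hq1 hc (inv_ne_zero hw) k j
    rw [show 2 * c * w⁻¹ * q ^ (k + 1) / q ^ j = q * (2 * c * q ^ k / q ^ j) / w by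
        rw [pow_succ]; ring,
      show 2 * c * w * q ^ (k + 1) / q ^ j = q * (2 * c * q ^ k / q ^ j) * w by
        rw [pow_succ]; ring,
      show q * (w⁻¹) ^ 2 = q / w ^ 2 by rw [inv_pow]; rfl, div_inv_eq_mul, div_eq_mul_inv d w]
    rw [← div_eq_mul_inv (2 * c * q ^ k / q ^ j) w] at c2
    generalize psiSeries q (q / w ^ 2) (q * (2 * c * q ^ k / q ^ j) / w) = p1 at *
    generalize psiSeries q (q * w ^ 2) (q * (2 * c * q ^ k / q ^ j) * w) = p2 at *
    generalize psiSeries q (q / (2 * c * q ^ k / q ^ j * w)) (q * w / (2 * c * q ^ k / q ^ j)) = p3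
      at *
    have hk : w ^ k * (w⁻¹) ^ k = 1 := by rw [← mul_pow, mul_inv_cancel₀ hw, one_pow]
    have hww : w⁻¹ * w ^ 2 = w := by field_simp
    generalize thetaProd q (2 * c * q ^ k / q ^ j * w) = T1 at *
    generalize thetaProd q (2 * c * q ^ k / q ^ j / w) = T2 at *
    generalize (d * (q / (2 * c * q ^ k))) ^ j * (q ^ j.choose 2 * q ^ j.choose 2) = E at *
    have lhs : w⁻¹ * w⁻¹ ^ k * thetaProd q (2 * c * w) *
        ((-(d * w)) ^ j * q ^ j.choose 2 / qRising q q j * p1) -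
        w * w ^ k * thetaProd q (2 * c * w⁻¹) *
        ((-(d * w⁻¹)) ^ j * q ^ j.choose 2 / qRising q q j * p2) =
        (w⁻¹ * w⁻¹ ^ k * (thetaProd q (2 * c * w) * (-(d * w)) ^ j * q ^ j.choose 2) * p1 -
        w * w ^ k * (thetaProd q (2 * c * w⁻¹) * (-(d * w⁻¹)) ^ j * q ^ j.choose 2) * p2) /
          qRising q q j := by ring
    rw [lhs, c1, c2]
    linear_combination (w⁻¹ * ((-(2 * c)) ^ k * q ^ k.choose 2 * E * T1) * p1 -
        w * ((-(2 * c)) ^ k * q ^ k.choose 2 * E * T2) * p2) / qRising q q j * hk -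
      ((-(2 * c)) ^ k * q ^ k.choose 2 * w⁻¹ * E / qRising q q j) * hconn +
      ((-(2 * c)) ^ k * q ^ k.choose 2 * E * T2 * p2 / qRising q q j) * hww
  have hneg : (-c) ^ k = (-(2 * c)) ^ k / 2 ^ k := by
    rw [← div_pow]; congr 1; ring
  generalize (∑' j : ℕ, (-(d / w⁻¹)) ^ j * q ^ j.choose 2 / qRising q q j *
    psiSeries q (q * (w⁻¹) ^ 2) (2 * c * w⁻¹ * q ^ (k + 1) / q ^ j)) = Sm at *
  generalize (∑' j : ℕ, (-(d / w)) ^ j * q ^ j.choose 2 / qRising q q j *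
    psiSeries q (q * w ^ 2) (2 * c * w * q ^ (k + 1) / q ^ j)) = Sp at *
  generalize (∑' j : ℕ, (d * (q / (2 * c * q ^ k))) ^ j * (q ^ j.choose 2 * q ^ j.choose 2) /
    qRising q q j * psiSeries q (q / (2 * c * q ^ k / q ^ j * w))
      (q * w / (2 * c * q ^ k / q ^ j))) = S at *
  have hI := qRisingInf_self_ne_zero hq1
  have hw2 : 1 - (w ^ 2)⁻¹ ≠ 0 := by
    have h0 := hθ 0
    rw [zpow_zero, expI_two_mul, ← hwdef] at h0
    rw [sub_ne_zero, ne_comm, Ne, inv_eq_one]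
    exact h0
  -- This exhibits the theta product of w² in the normalisation; the leftover 1 - w⁻² cancels
  -- against w - w⁻¹, which comes from the sine.
  have e1 : qRisingInf (w ^ 2)⁻¹ q = (1 - (w ^ 2)⁻¹) * qRisingInf (q / w ^ 2) q := by
    rw [qRisingInf_eq_one_sub_mul _ hq1, inv_mul_eq_div]
  rw [thetaProd] at htp htm htw
  have i1 := left_ne_zero_of_mul htp
  have i2 := right_ne_zero_of_mul htp
  have i3 := left_ne_zero_of_mul htm
  have i4 := right_ne_zero_of_mul htm
  have i5 := left_ne_zero_of_mul htw
  have i6 := right_ne_zero_of_mul htw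
  -- The extra factors on the left complete (2cw, 2c/w; q)_∞ to two theta products: in each half one
  -- cancels the denominator and the other survives.
  have lhs : 2 * (w⁻¹ - w) / (1 - q) * (qRisingInf (2 * c * w) q * qRisingInf (2 * c * w⁻¹) q /
        (qRisingInf q q * qRisingInf (w ^ 2) q * qRisingInf (w ^ 2)⁻¹ q)) *
      (w / 2 * (1 - q) * ((w / 2) ^ k * qRisingInf q q / thetaProd q (2 * c * w) * Sp) -
        w⁻¹ / 2 * (1 - q) * ((w⁻¹ / 2) ^ k * qRisingInf q q / thetaProd q (2 * c * w⁻¹) * Sm)) *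
      (qRisingInf (q / (2 * c * w)) q * qRisingInf (q / (2 * c * w⁻¹)) q) =
      (w - w⁻¹) / (qRisingInf (w ^ 2) q * ((1 - (w ^ 2)⁻¹) * qRisingInf (q / w ^ 2) q)) / 2 ^ k *
        (w⁻¹ * (w⁻¹) ^ k * thetaProd q (2 * c * w) * Sm -
          w * w ^ k * thetaProd q (2 * c * w⁻¹) * Sp) := by
    rw [e1, thetaProd, thetaProd, div_pow w, div_pow w⁻¹]
    generalize qRisingInf (2 * c * w) q = a1 at *
    generalize qRisingInf (q / (2 * c * w)) q = a2 at *
    generalize qRisingInf (2 * c * w⁻¹) q = a3 at *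
    generalize qRisingInf (q / (2 * c * w⁻¹)) q = a4 at *
    generalize qRisingInf (w ^ 2) q = a5 at *
    generalize qRisingInf (q / w ^ 2) q = a6 at *
    generalize qRisingInf q q = a7 at *
    generalize 1 - (w ^ 2)⁻¹ = a8 at *
    generalize w⁻¹ ^ k = v1 at *
    generalize w ^ k = v2 at *
    generalize w⁻¹ = v3 at *
    field_simp
    ring
  rw [lhs, hcomb, hneg, thetaProd]
  have hww : w - w⁻¹ = w * (1 - (w ^ 2)⁻¹) := by field_simp
  rw [hww]
  generalize 1 - (w ^ 2)⁻¹ = a8 at *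
  field_simp

/-! ### The recurrence. -/

theorem pIntegrand_eq_pow_mul (q b c lam θ : ℂ) (k : ℕ) (t : ℂ) :
    pIntegrand q b c lam θ k t = t ^ k * pIntegrand q b c lam θ 0 t := by
  rw [pIntegrand, pIntegrand, pow_zero, one_mul]

/-- A q-Pearson equation: passing from t to tq changes each infinite product by a single factor. -/
theorem pIntegrand_zero_shift {q b c t : ℂ} (hq0 : q ≠ 0) (hq : ‖q‖ < 1) (hb : b ≠ 0) (hc : c ≠ 0)
    (ht : t ≠ 0) (hct : 4 * c * t ≠ 1) (lam θ : ℂ) :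
    pIntegrand q b c lam θ 0 (t * q) *
        ((1 - 2 * expI θ * (t * q)) * (1 - 2 * expI (-θ) * (t * q))) =
      -(4 * c * t + lam / b) * pIntegrand q b c lam θ 0 t := by
  rw [pIntegrand, pIntegrand, pow_zero, pow_zero, one_mul, one_mul,
    qRisingInf_eq_one_sub_mul (2 * q * expI θ * t) hq,
    qRisingInf_eq_one_sub_mul (2 * q * expI (-θ) * t) hq, qRisingInf_eq_one_sub_mul (4 * c * t) hq,
    qRisingInf_eq_one_sub_mul (-(lam * q) / (4 * b * c * (t * q))) hq,
    qRisingInf_eq_one_sub_mul (q / (4 * c * (t * q))) hq,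
    show 2 * q * expI θ * t * q = 2 * q * expI θ * (t * q) by ring,
    show 2 * q * expI (-θ) * t * q = 2 * q * expI (-θ) * (t * q) by ring,
    show 4 * c * t * q = 4 * c * (t * q) by ring,
    show -(lam * q) / (4 * b * c * (t * q)) * q = -(lam * q) / (4 * b * c * t) by field_simp,
    show q / (4 * c * (t * q)) * q = q / (4 * c * t) by field_simp]
  have h1 : 1 - 4 * c * t ≠ 0 := sub_ne_zero.2 hct.symm
  have e : (1 - -(lam * q) / (4 * b * c * (t * q))) * (1 - 4 * c * t) =
      -(4 * c * t + lam / b) * (1 - q / (4 * c * (t * q))) := by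
    field_simp
    ring
  have h2 : 1 - q / (4 * c * (t * q)) ≠ 0 := by
    rw [show q / (4 * c * (t * q)) = 1 / (4 * c * t) by field_simp]
    intro h
    apply hct
    have : 4 * c * t ≠ 0 := mul_ne_zero (mul_ne_zero (by norm_num) hc) ht
    rw [sub_eq_zero, eq_div_iff this, one_mul] at h
    exact h
  have e' : (1 - -(lam * q) / (4 * b * c * (t * q))) / (1 - q / (4 * c * (t * q))) =
      -(4 * c * t + lam / b) / (1 - 4 * c * t) := by
    rw [div_eq_div_iff h2 h1, e]
  generalize qRisingInf (2 * q * expI θ * (t * q)) q = a1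
  generalize qRisingInf (2 * q * expI (-θ) * (t * q)) q = a2
  generalize qRisingInf (4 * c * (t * q)) q = a3
  generalize qRisingInf (-(lam * q) / (4 * b * c * t)) q = a4
  generalize qRisingInf (q / (4 * c * t)) q = a5
  have l : ∀ X Y : ℂ, a1 * a2 * (X * a4) / (a3 * (Y * a5)) = X / Y * (a1 * a2 * a4 / (a3 * a5)) :=
    fun X Y => by ring
  have r : ∀ X Y Z : ℂ, X * a1 * (Y * a2) * a4 / (Z * a3 * a5) =
      X * Y * (a1 * a2 * a4 / (a3 * a5)) / Z := fun X Y Z => by ring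
  rw [l, r, e']
  ring

theorem two_mul_cos (θ : ℂ) : 2 * Complex.cos θ = expI θ + expI (-θ) := by
  rw [Complex.two_cos, expI, expI]
  ring_nf

theorem expI_mul_expI_neg (θ : ℂ) : expI θ * expI (-θ) = 1 := by
  rw [expI_neg, mul_inv_cancel₀ (expI_ne_zero θ)]

theorem tsum_pIntegrand_recurrence {q b c lam θ : ℂ} (hq0 : q ≠ 0) (hq : ‖q‖ < 1) (hb : b ≠ 0)
    (hc : c ≠ 0) (hcθ : ∀ m : ℤ, 2 * c * expI θ ≠ q ^ m) (hlam : ‖lam * q / b‖ < 1) (k : ℕ) :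
    Complex.cos θ * ∑' n : ℕ, q ^ n * pIntegrand q b c lam θ (k + 1) (expI θ / 2 * q ^ n) =
      ∑' n : ℕ, q ^ n * pIntegrand q b c lam θ (k + 2) (expI θ / 2 * q ^ n) +
      c * q ^ (k + 1) * ∑' n : ℕ, q ^ n * pIntegrand q b c lam θ (k + 1) (expI θ / 2 * q ^ n) +
      1 / 4 * (1 + lam * q ^ (k + 1) / b) *
        ∑' n : ℕ, q ^ n * pIntegrand q b c lam θ k (expI θ / 2 * q ^ n) := by
  have s0 := summable_pow_mul_pIntegrand hq0 hq hb hc hcθ hlam k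
  have s1 := summable_pow_mul_pIntegrand hq0 hq hb hc hcθ hlam (k + 1)
  have s2 := summable_pow_mul_pIntegrand hq0 hq hb hc hcθ hlam (k + 2)
  have hw := expI_ne_zero θ
  have hE := expI_mul_expI_neg θ
  set f := fun (j n : ℕ) => q ^ n * pIntegrand q b c lam θ j (expI θ / 2 * q ^ n) with hf
  have hfk : ∀ j n, f j n = (expI θ / 2 * q ^ n) ^ j * f 0 n := fun j n => by
    simp only [hf]
    rw [pIntegrand_eq_pow_mul q b c lam θ j]
    ring
  have sG : Summable fun n => 4 * f (k + 2) n - 4 * Complex.cos θ * f (k + 1) n + f k n :=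
    ((s2.mul_left 4).sub (s1.mul_left (4 * Complex.cos θ))).add s0
  have e1 : 4 * (∑' n, f (k + 2) n) - 4 * Complex.cos θ * (∑' n, f (k + 1) n) + ∑' n, f k n =
      ∑' n, (4 * f (k + 2) n - 4 * Complex.cos θ * f (k + 1) n + f k n) := by
    rw [((s2.mul_left 4).sub (s1.mul_left (4 * Complex.cos θ))).tsum_add s0,
      (s2.mul_left 4).tsum_sub (s1.mul_left (4 * Complex.cos θ)), tsum_mul_left, tsum_mul_left]
  -- Here 4t² - 4xt + 1 = (1 - 2wt)(1 - 2t/w) at t = w q^n / 2.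
  have hG : ∀ n, 4 * f (k + 2) n - 4 * Complex.cos θ * f (k + 1) n + f k n =
      f k n * ((1 - 2 * expI θ * (expI θ / 2 * q ^ n)) *
        (1 - 2 * expI (-θ) * (expI θ / 2 * q ^ n))) := fun n => by
    rw [hfk (k + 2), hfk (k + 1), hfk k]
    have h2 := two_mul_cos θ
    linear_combination (-2 * (expI θ / 2 * q ^ n) ^ (k + 1) * f 0 n) * h2 -
      (4 * (expI θ / 2 * q ^ n) ^ (k + 2) * f 0 n) * hE
  -- The endpoint t = w/2 is a zero of 1 - 2t/w, so the shift in n leaves no boundary term.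
  have h0 : 4 * f (k + 2) 0 - 4 * Complex.cos θ * f (k + 1) 0 + f k 0 = 0 := by
    rw [hG, pow_zero]
    linear_combination (-f k 0 * (1 - 2 * expI θ * (expI θ / 2 * 1))) * hE
  have hS : ∀ n, 4 * f (k + 2) (n + 1) - 4 * Complex.cos θ * f (k + 1) (n + 1) + f k (n + 1) =
      -(q ^ (k + 1) * (4 * c)) * f (k + 1) n - q ^ (k + 1) * (lam / b) * f k n := fun n => by
    have ht : expI θ / 2 * q ^ n ≠ 0 := mul_ne_zero (div_ne_zero hw two_ne_zero) (pow_ne_zero _ hq0)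
    have hct : 4 * c * (expI θ / 2 * q ^ n) ≠ 1 := fun h => hcθ (-n) (by
      rw [zpow_neg, zpow_natCast]
      refine eq_inv_of_mul_eq_one_left ?_
      rw [← h]; ring)
    have hsh := pIntegrand_zero_shift hq0 hq hb hc ht hct lam θ
    rw [hG, hfk k (n + 1), hfk (k + 1) n, hfk k n]
    simp only [hf]
    rw [show expI θ / 2 * q ^ (n + 1) = expI θ / 2 * q ^ n * q by ring]
    linear_combination ((expI θ / 2 * q ^ n * q) ^ k * q ^ (n + 1)) * hsh
  rw [sG.tsum_eq_zero_add, h0, zero_add] at e1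
  simp only [hS] at e1
  rw [(s1.mul_left _).tsum_sub (s0.mul_left _), tsum_mul_left, tsum_mul_left] at e1
  linear_combination -1 / 4 * e1

/-- The relation holds for each half of the q-integral separately; the second half is the first with
-θ. -/
theorem pFun_recurrence {q b c lam θ : ℂ} (hq0 : q ≠ 0) (hq : ‖q‖ < 1) (hb : b ≠ 0)
    (hc : c ≠ 0) (hcθ : ∀ m : ℤ, 2 * c * expI θ ≠ q ^ m)
    (hcθ' : ∀ m : ℤ, 2 * c * expI (-θ) ≠ q ^ m) (hlam : ‖lam * q / b‖ < 1) (k : ℕ) :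
    Complex.cos θ * pFun q b c lam θ (k + 1) =
      pFun q b c lam θ (k + 2) + c * q ^ (k + 1) * pFun q b c lam θ (k + 1) +
        1 / 4 * (1 + lam * q ^ (k + 1) / b) * pFun q b c lam θ k := by
  have h1 := tsum_pIntegrand_recurrence hq0 hq hb hc hcθ hlam k
  have h2 := tsum_pIntegrand_recurrence hq0 hq hb hc hcθ' hlam k
  simp only [pIntegrand_neg, Complex.cos_neg] at h2
  simp only [pFun, qIntegral]
  generalize 4 * (-Complex.I * Complex.sin θ) / (1 - q) *
    (qRisingInf (2 * c * expI θ) q * qRisingInf (2 * c * expI (-θ)) q /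
      (qRisingInf q q * qRisingInf (expI (2 * θ)) q * qRisingInf (expI (-(2 * θ))) q)) = C
  linear_combination C * (expI θ / 2 * (1 - q)) * h1 - C * (expI (-θ) / 2 * (1 - q)) * h2

/-! ### Independence of the angle, and the closed forms. -/

theorem pFun_congr {q b c lam θ θ' : ℂ} (h : expI θ' = expI θ) (k : ℕ) :
    pFun q b c lam θ' k = pFun q b c lam θ k := by
  have h' : expI (-θ') = expI (-θ) := by rw [expI_neg, expI_neg, h]
  have hi : pIntegrand q b c lam θ' k = pIntegrand q b c lam θ k := by
    funext t
    rw [pIntegrand, pIntegrand, h, h']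
  rw [pFun, pFun, neg_I_mul_sin, neg_I_mul_sin, hi, expI_neg (2 * θ'), expI_neg (2 * θ),
    expI_two_mul, expI_two_mul, h', h]

theorem pFun_eq_of_cos_eq {q b c lam θ θ' : ℂ} (h : Complex.cos θ = Complex.cos θ') (k : ℕ) :
    pFun q b c lam θ' k = pFun q b c lam θ k := by
  have hper : ∀ (n : ℤ) (y : ℂ), expI (2 * n * Real.pi + y) = expI y := fun n y => by
    rw [expI, expI, mul_add, Complex.exp_add,
      show Complex.I * (2 * n * Real.pi) = n * (2 * Real.pi * Complex.I) by ring,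
      Complex.exp_int_mul_two_pi_mul_I, one_mul]
  obtain ⟨n, hn | hn⟩ := Complex.cos_eq_cos_iff.1 h
  · exact pFun_congr (by rw [hn, hper]) k
  · rw [← pFun_neg q b c lam θ]
    exact pFun_congr (by rw [hn, sub_eq_add_neg, hper]) k

/-- The factor (γ; q)_∞ clears the denominators (γ; q)_n, giving the series transformed by
`qRisingInf_mul_tsum_eq`. -/
theorem phi21_zero_mul {α γ q z : ℂ} (hq : ‖q‖ < 1) (hγ : ∀ n : ℕ, γ * q ^ n ≠ 1) :
    qRisingInf γ q * phi21 α 0 γ q z =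
      ∑' n : ℕ, qRising α q n / qRising q q n * z ^ n * qRisingInf (γ * q ^ n) q := by
  rw [phi21, ← tsum_mul_left]
  refine tsum_congr fun n => ?_
  rw [phi21Term, qRising_zero_left, qRisingInf_eq_mul γ hq n]
  have := qRising_ne_zero hγ n
  field_simp

theorem summable_phi21Term_zero {α γ q z : ℂ} (hq : ‖q‖ < 1) (hγ : ∀ n : ℕ, γ * q ^ n ≠ 1)
    (hz : ‖z‖ < 1) : Summable (phi21Term α 0 γ q z) := by
  refine (summable_norm_mul_of_bounded (summable_norm_qBinomial α hq hz)
    (exists_norm_inv_qRising_le hq hγ)).of_norm.congr fun n => ?_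
  rw [phi21Term, qRising_zero_left]
  ring

theorem hasClosedForm_self {q b c lam θ : ℂ}
    (hq0 : q ≠ 0) (hq1 : ‖q‖ < 1) (hb : b ≠ 0) (hc : c ≠ 0)
    (hθ : ∀ m : ℤ, expI (2 * θ) ≠ q ^ m)
    (hcθ : ∀ m : ℤ, 2 * c * expI θ ≠ q ^ m)
    (hcθ' : ∀ m : ℤ, 2 * c * expI (-θ) ≠ q ^ m)
    (hlam : ‖lam * q / b‖ < 1) (hl : lam ≠ 0) (hd : ‖lam * q / (2 * b * c)‖ < 1)
    (he : ‖expI (-θ)‖ ≤ 1) (k : ℕ) : HasClosedForm q b c lam θ θ k := by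
  have hw := expI_ne_zero θ
  have hqk : q ^ k ≠ 0 := pow_ne_zero _ hq0
  have hz : ‖-(lam * q / (2 * b * c)) * expI (-θ)‖ < 1 := by
    rw [norm_mul, norm_neg]
    exact (mul_le_of_le_one_right (norm_nonneg _) he).trans_lt hd
  have hγe : q ^ (1 - (k : ℤ)) * expI θ / (2 * c) = q / q ^ k * expI θ / (2 * c) := by
    rw [zpow_sub₀ hq0, zpow_one, zpow_natCast]
  have hγ : ∀ n : ℕ, q ^ (1 - (k : ℤ)) * expI θ / (2 * c) * q ^ n ≠ 1 := fun n h => by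
    refine hcθ' (1 - k + n) ?_
    rw [expI_neg, zpow_add₀ hq0, zpow_natCast]
    field_simp at h ⊢
    rw [← h]
  refine ⟨summable_phi21Term_zero hq1 hγ hz, ?_⟩
  have hmain := pFun_mul_eq hq0 hq1 hb hc hθ hcθ hcθ' hlam k
  have hphi := phi21_zero_mul (α := -b * q ^ (-(k : ℤ)) / lam)
    (z := -(lam * q / (2 * b * c)) * expI (-θ)) hq1 hγ
  -- With α = -b q^{-k}/λ and D = -λq/(2bcw), the product αD = q/(2c q^k w) is free of λ and b; it
  -- is the first argument of ψ in `pFun_mul_eq` at j = 0.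
  have hT := qRisingInf_mul_tsum_eq hq1 hz (-b * q ^ (-(k : ℤ)) / lam)
    (q ^ (1 - (k : ℤ)) * expI θ / (2 * c))
  rw [← hphi, ← tsum_psiSeries_eq hq1] at hT
  have hser : (∑' j : ℕ, (-(lam * q / (2 * b * c)) * (q / (2 * c * q ^ k))) ^ j *
      (q ^ j.choose 2 * q ^ j.choose 2) / qRising q q j *
        psiSeries q (q / (2 * c * q ^ k / q ^ j * expI θ))
          (q * expI θ / (2 * c * q ^ k / q ^ j))) =
      ∑' j : ℕ, (-(lam * q / (2 * b * c)) * expI (-θ) *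
        (q ^ (1 - (k : ℤ)) * expI θ / (2 * c))) ^ j *
        (q ^ j.choose 2 * q ^ j.choose 2) / qRising q q j *
        psiSeries q (-b * q ^ (-(k : ℤ)) / lam * (-(lam * q / (2 * b * c)) * expI (-θ)) * q ^ j)
          (q ^ (1 - (k : ℤ)) * expI θ / (2 * c) * q ^ j) := by
    refine tsum_congr fun j => ?_
    have hqj : q ^ j ≠ 0 := pow_ne_zero _ hq0
    rw [hγe, expI_neg, zpow_neg, zpow_natCast]
    have e1 : -(lam * q / (2 * b * c)) * (q / (2 * c * q ^ k)) =
        -(lam * q / (2 * b * c)) * (expI θ)⁻¹ * (q / q ^ k * expI θ / (2 * c)) := by field_simp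
    have e2 : q / (2 * c * q ^ k / q ^ j * expI θ) =
        -b * (q ^ k)⁻¹ / lam * (-(lam * q / (2 * b * c)) * (expI θ)⁻¹) * q ^ j := by field_simp
    have e3 : q * expI θ / (2 * c * q ^ k / q ^ j) =
        q / q ^ k * expI θ / (2 * c) * q ^ j := by field_simp
    rw [e1, e2, e3]
  rw [hser, ← hT] at hmain
  have t1 := thetaProd_ne_zero hq0 hq1 hcθ
  have t2 := thetaProd_ne_zero hq0 hq1 hcθ'
  rw [thetaProd] at t1 t2
  rw [expI_neg] at t2
  have i1 := right_ne_zero_of_mul t1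
  have i2 := right_ne_zero_of_mul t2
  -- For γ = q^{1-k} w/(2c), (γ; q)_∞ splits after k factors. Reversing the first k yields (2c/w;
  -- q)_k, and the accompanying powers combine with (-c)^k q^{k(k-1)/2} to (w/2)^k.
  have hx : q / q ^ k * expI θ / (2 * c) * q ^ k = q / (2 * c * (expI θ)⁻¹) := by field_simp
  have hγ0 : q / q ^ k * expI θ / (2 * c) ≠ 0 :=
    div_ne_zero (mul_ne_zero (div_ne_zero hq0 hqk) hw) (mul_ne_zero two_ne_zero hc)
  have hrefl := qRising_reflect hq0 hγ0 k hx
  rw [show q / (q / (2 * c * (expI θ)⁻¹)) = 2 * c * (expI θ)⁻¹ by field_simp] at hrefl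
  have hcancel := pow_mul_choose_two_cancel hq0 k
  have hI : qRisingInf (q / q ^ k * expI θ / (2 * c)) q =
      qRising (q / q ^ k * expI θ / (2 * c)) q k * qRisingInf (q / (2 * c * (expI θ)⁻¹)) q := by
    rw [qRisingInf_eq_mul _ hq1 k, hx]
  have hcoef : (-c) ^ k * q ^ k.choose 2 * ((-(q / q ^ k * expI θ / (2 * c))) ^ k *
      q ^ k.choose 2) = expI θ ^ k / 2 ^ k := by
    rw [← div_pow, show expI θ / 2 = -c * -(expI θ / (2 * c)) by field_simp, mul_pow (-c),
      show -(q / q ^ k * expI θ / (2 * c)) = q / q ^ k * -(expI θ / (2 * c)) by ring,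
      mul_pow (q / q ^ k)]
    linear_combination ((-c) ^ k * (-(expI θ / (2 * c))) ^ k) * hcancel
  rw [pClosed, expI_natCast_mul, expI_neg]
  rw [expI_neg, hγe, hI, hrefl] at hmain
  rw [hγe, show q / (2 * c) * (expI θ)⁻¹ = q / (2 * c * expI θ) by field_simp]
  refine mul_right_cancel₀ (mul_ne_zero i1 i2) (hmain.trans ?_)
  generalize phi21 _ _ _ _ _ = Φ
  generalize qRisingInf (-(lam * q / (2 * b * c)) * (expI θ)⁻¹) q = z1
  generalize qRisingInf (q / (2 * c * expI θ)) q = z2 at *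
  generalize qRisingInf (q / (2 * c * (expI θ)⁻¹)) q = z3 at *
  generalize qRising (2 * c * (expI θ)⁻¹) q k = z4 at *
  have e : expI θ ^ k * z4 * z1 / (2 ^ k * z2) * Φ * (z2 * z3) =
      expI θ ^ k / 2 ^ k * (z4 * z1 * Φ * z3) := by field_simp
  rw [e, ← hcoef]
  ring

theorem norm_expI (θ : ℂ) : ‖expI θ‖ = Real.exp (-θ.im) := by
  rw [expI, Complex.norm_exp]
  simp

theorem cos_im_eq (θ : ℂ) : (Complex.cos θ).im = -(Real.sin θ.re * Real.sinh θ.im) := by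
  rw [Complex.cos_eq, ← Complex.ofReal_cos, ← Complex.ofReal_sin, ← Complex.ofReal_cosh,
    ← Complex.ofReal_sinh]
  simp only [Complex.sub_im, Complex.mul_im, Complex.mul_re, Complex.I_re, Complex.I_im,
    Complex.ofReal_re, Complex.ofReal_im]
  ring

theorem mainTheorem4 (q b c lam x θ : ℂ)
    (hq0 : q ≠ 0) (hq1 : ‖q‖ < 1) (hb : b ≠ 0) (hc : c ≠ 0)
    (hx : x = Complex.cos θ)
    -- no denominator in the definition of `p_k` vanishes
    (hθ : ∀ m : ℤ, expI (2 * θ) ≠ q ^ m)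
    (hcθ : ∀ m : ℤ, 2 * c * expI θ ≠ q ^ m)
    (hcθ' : ∀ m : ℤ, 2 * c * expI (-θ) ≠ q ^ m)
    (hlam : ‖lam * q / b‖ < 1) :
    -- the `q`-integrals converge
    (∀ k : ℕ, QIntegrable q (pIntegrand q b c lam θ k) (expI (-θ) / 2) (expI θ / 2)) ∧
    -- `p_k` depends on `x` only
    (∀ θ' : ℂ, x = Complex.cos θ' → ∀ k : ℕ, pFun q b c lam θ' k = pFun q b c lam θ k) ∧
    -- the recurrence relation
    (∀ k : ℕ, 0 < k →
      x * pFun q b c lam θ k =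
        pFun q b c lam θ (k + 1) + c * q ^ k * pFun q b c lam θ k +
          1 / 4 * (1 + lam * q ^ k / b) * pFun q b c lam θ (k - 1)) ∧
    -- the closed forms
    (lam ≠ 0 → ‖lam * q / (2 * b * c)‖ < 1 →
      -- for any determination of `θ`, according to which of `|e^{∓iθ}|` is at most `1`
      ((‖expI (-θ)‖ ≤ 1 → ∀ k : ℕ, HasClosedForm q b c lam θ θ k) ∧
        (‖expI θ‖ ≤ 1 → ∀ k : ℕ, HasClosedForm q b c lam θ (-θ) k)) ∧
      -- for the principal determination of `θ`, according to the sign of `Im x`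
      (0 < θ.re → θ.re < Real.pi →
        (0 ≤ x.im → ∀ k : ℕ, HasClosedForm q b c lam θ θ k) ∧
        (x.im ≤ 0 → ∀ k : ℕ, HasClosedForm q b c lam θ (-θ) k))) := by
  subst hx
  refine ⟨fun k => ⟨?_, ?_⟩, fun θ' h k => pFun_eq_of_cos_eq h k, fun k hk => ?_, fun hl hd => ?_⟩
  · exact summable_pow_mul_pIntegrand hq0 hq1 hb hc hcθ hlam k
  · simpa only [pIntegrand_neg] using summable_pow_mul_pIntegrand hq0 hq1 hb hc hcθ' hlam k
  · obtain ⟨m, rfl⟩ : ∃ m, k = m + 1 := ⟨k - 1, by omega⟩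
    exact pFun_recurrence hq0 hq1 hb hc hcθ hcθ' hlam m
  · have ha : ‖expI (-θ)‖ ≤ 1 → ∀ k : ℕ, HasClosedForm q b c lam θ θ k :=
      hasClosedForm_self hq0 hq1 hb hc hθ hcθ hcθ' hlam hl hd
    have hb' : ‖expI θ‖ ≤ 1 → ∀ k : ℕ, HasClosedForm q b c lam θ (-θ) k := fun he k => by
      have hθ' : ∀ m : ℤ, expI (2 * -θ) ≠ q ^ m := fun m h => hθ (-m) (by
        rw [zpow_neg, ← h, mul_neg, expI_neg, inv_inv])
      have h := hasClosedForm_self hq0 hq1 hb hc hθ' hcθ' (by rwa [neg_neg]) hlam hl hd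
        (by rwa [neg_neg]) k
      exact ⟨h.1, (pFun_neg q b c lam θ k).symm.trans h.2⟩
    refine ⟨⟨ha, hb'⟩, fun h0 hpi => ?_⟩
    -- As sin(Re θ) > 0, Im x has the sign of -Im θ, while |e^{-iθ}| = e^{Im θ}.
    have hsin := Real.sin_pos_of_pos_of_lt_pi h0 hpi
    rw [cos_im_eq]
    refine ⟨fun him => ha ?_, fun him => hb' ?_⟩
    · rw [norm_expI, Complex.neg_im, neg_neg, Real.exp_le_one_iff, ← Real.sinh_nonpos_iff]
      nlinarith
    · rw [norm_expI, Real.exp_le_one_iff, neg_nonpos, ← Real.sinh_nonneg_iff]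
      nlinarith
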